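/- Let $\mathbb D$ be the open unit disc. For a domain $D\subset\mathbb C^2$ and a holomorphic map $f:\mathbb D\to D$, a left inverse of $f$ in $D$ is a holomorphic function $F:D\to\mathbb D$ with $F\circ f=\mathrm{id}_{\mathbb D}$; the map $f$ is a complex geodesic in $D$ if $c_D(f(\lambda_1),f(\lambda_2))=p(\lambda_1,\lambda_2)$ for some $\lambda_1\neq\lambda_2$ in $\mathbb D$, where $c_D$ is the Carathéodory pseudodistance of $D$ and $p$ is the Poincaré distance of $\mathbb D$. If $\partial D$ is $\mathcal C^\infty$ near $q\in\partial D$ with local defining function $\rho$, it is of infinite type at $q$ if $\sup_\gamma \nu(\rho\circ\gamma)/\nu(\gamma-q)=\infty$, the supremum being over all nonconstant germs of holomorphic curves $\gamma:(\mathbb C,0)\to(\mathbb C^2,q)$ and $\nu$ denoting the order of vanishing at $0$. (1) Let $D\subset\mathbb C^2$ be a (not necessarily bounded) pseudoconvex complete Reinhardt domain such that $p_0=(1,0)\in\partial D$ and $\partial D$ is $\mathcal C^\infty$ smooth in a neighbourhood of $p_0$. Then $f:\mathbb D\ni\lambda\mapsto(\lambda,0)\in D$ is a complex geodesic in $D$,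 and $f$ has a unique left inverse in $D$ if and only if $\partial D$ is of infinite type at $p_0$. (2) There is a bounded convex complete Reinhardt domain $D\subset\mathbb C^2$ with $\mathcal C^\infty$ boundary containing $(1,0)$, strictly convex in the sense that $\partial D$ contains no nondegenerate segment, such that: any two complex geodesics in $D$ passing through the same two distinct points differ by an automorphism of $\mathbb D$; the map $\mathbb D\ni\lambda\mapsto(\lambda,0)$ is a complex geodesic in $D$; and its only left inverse in $D$ is the projection $(z,w)\mapsto z$. -/

import Mathlib

open Set Filter Topology Metric
open scoped ContDiff ENNReal

noncomputable section

/-- A set `D ⊆ ℂ²` is complete Reinhardt if `(z, w) ∈ D` and `|a|, |b| ≤ 1` imply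
`(a z, b w) ∈ D`. -/
def IsCompleteReinhardt (D : Set (ℂ × ℂ)) : Prop :=
  ∀ z ∈ D, ∀ a b : ℂ, ‖a‖ ≤ 1 → ‖b‖ ≤ 1 → (a * z.1, b * z.2) ∈ D

/-- A continuous function `u` on the open set `D` is plurisubharmonic if it satisfies the
sub-mean value inequality on every closed affine complex disc
`{z + ζ v : |ζ| ≤ 1}` contained in `D`. -/
def IsContinuousPSHOn (u : ℂ × ℂ → ℝ) (D : Set (ℂ × ℂ)) : Prop :=
  ContinuousOn u D ∧
    ∀ z v : ℂ × ℂ, (∀ ζ : ℂ, ‖ζ‖ ≤ 1 → z + ζ • v ∈ D) →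
      u z ≤ Real.circleAverage (fun ζ : ℂ => u (z + ζ • v)) 0 1

/-- Pseudoconvexity of an open set: existence of a continuous plurisubharmonic exhaustion
function. -/
def IsPseudoconvex (D : Set (ℂ × ℂ)) : Prop :=
  ∃ u : ℂ × ℂ → ℝ, IsContinuousPSHOn u D ∧ ∀ c : ℝ, IsCompact {z | z ∈ D ∧ u z ≤ c}

/-- `ρ` is a `C^∞` local defining function, on the open neighbourhood `U` of `p`, of the open set
`D` near its boundary point `p`. (The nonvanishing of the differential forces
`U ∩ frontier D = {ρ = 0}`.) -/
def IsLocalDefiningFunction (D : Set (ℂ × ℂ)) (p : ℂ × ℂ) (U : Set (ℂ × ℂ))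
    (ρ : ℂ × ℂ → ℝ) : Prop :=
  IsOpen U ∧ p ∈ U ∧ ContDiffOn ℝ ∞ ρ U ∧ (∀ z ∈ U, z ∈ D ↔ ρ z < 0) ∧
    ∀ z ∈ U, ρ z = 0 → fderiv ℝ ρ z ≠ 0

/-- The boundary of the open set `D` is `C^∞` smooth in a neighbourhood of `p`. -/
def HasSmoothBoundaryNear (D : Set (ℂ × ℂ)) (p : ℂ × ℂ) : Prop :=
  ∃ (U : Set (ℂ × ℂ)) (ρ : ℂ × ℂ → ℝ), IsLocalDefiningFunction D p U ρ

/-- The order of vanishing at `0 ∈ ℂ`: the supremum of all `n` with `g(ζ) = O(|ζ|ⁿ)`. -/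
def vanishingOrder {E : Type*} [NormedAddCommGroup E] (g : ℂ → E) : ℕ∞ :=
  ⨆ n ∈ {n : ℕ | g =O[𝓝 0] fun ζ : ℂ => ‖ζ‖ ^ n}, (n : ℕ∞)

/-- Nonconstant germs at `0` of holomorphic curves in `ℂ²` through `p`. -/
def IsHolomorphicCurveThrough (γ : ℂ → ℂ × ℂ) (p : ℂ × ℂ) : Prop :=
  AnalyticAt ℂ γ 0 ∧ γ 0 = p ∧ ¬ ∀ᶠ ζ in 𝓝 (0 : ℂ), γ ζ = p

/-- The (D'Angelo) type at `p` of the hypersurface `{ρ = 0}`: the supremum over all nonconstant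
holomorphic curves `γ` through `p` of the normalized order of contact
`ν(ρ ∘ γ) / ν(γ - p)`. -/
def boundaryType (ρ : ℂ × ℂ → ℝ) (p : ℂ × ℂ) : ℝ≥0∞ :=
  ⨆ γ ∈ {γ : ℂ → ℂ × ℂ | IsHolomorphicCurveThrough γ p},
    ((vanishingOrder fun ζ => ρ (γ ζ) : ℕ∞) : ℝ≥0∞) /
      ((vanishingOrder fun ζ => γ ζ - p : ℕ∞) : ℝ≥0∞)

/-- The boundary of `D` is (smooth and) of infinite type at `p`. -/
def IsOfInfiniteTypeAt (D : Set (ℂ × ℂ)) (p : ℂ × ℂ) : Prop :=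
  ∃ (U : Set (ℂ × ℂ)) (ρ : ℂ × ℂ → ℝ),
    IsLocalDefiningFunction D p U ρ ∧ boundaryType ρ p = ⊤

/-- The Poincaré distance `artanh |(a - b) / (1 - conj a * b)|` on the unit disc. -/
def poincareDist (a b : ℂ) : ℝ :=
  Real.artanh ‖(a - b) / (1 - (starRingEnd ℂ) a * b)‖

/-- The Carathéodory pseudodistance of `D`. -/
def caratheodoryDist (D : Set (ℂ × ℂ)) (w z : ℂ × ℂ) : ℝ≥0∞ :=
  ⨆ F ∈ {F : ℂ × ℂ → ℂ | DifferentiableOn ℂ F D ∧ MapsTo F D (ball 0 1)},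
    ENNReal.ofReal (poincareDist (F w) (F z))

/-- A complex geodesic in `D`: a holomorphic map `f` from the unit disc to `D` such that
`c_D(f(λ₁), f(λ₂))` is the Poincaré distance of `λ₁` and `λ₂` for some pair of distinct points. -/
def IsComplexGeodesic (D : Set (ℂ × ℂ)) (f : ℂ → ℂ × ℂ) : Prop :=
  DifferentiableOn ℂ f (ball 0 1) ∧ MapsTo f (ball 0 1) D ∧
    ∃ l₁ ∈ ball (0 : ℂ) 1, ∃ l₂ ∈ ball (0 : ℂ) 1, l₁ ≠ l₂ ∧
      caratheodoryDist D (f l₁) (f l₂) = ENNReal.ofReal (poincareDist l₁ l₂)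

/-- Holomorphic automorphisms of the unit disc. -/
def IsDiscAutomorphism (a : ℂ → ℂ) : Prop :=
  DifferentiableOn ℂ a (ball 0 1) ∧ BijOn a (ball 0 1) (ball 0 1)

/-- The complex geodesics of `D` are unique: two of them passing through the same two distinct
points differ by an automorphism of the unit disc. -/
def HasUniqueGeodesics (D : Set (ℂ × ℂ)) : Prop :=
  ∀ f g : ℂ → ℂ × ℂ, IsComplexGeodesic D f → IsComplexGeodesic D g →
    ∀ w z : ℂ × ℂ, w ≠ z →
      w ∈ f '' ball 0 1 → z ∈ f '' ball 0 1 → w ∈ g '' ball 0 1 → z ∈ g '' ball 0 1 →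
        ∃ a : ℂ → ℂ, IsDiscAutomorphism a ∧ EqOn g (f ∘ a) (ball 0 1)

/-- `F` is a left inverse in `D` of `f`: a holomorphic function from `D` to the unit disc with
`F ∘ f = id` on the unit disc. -/
def IsLeftInverse (D : Set (ℂ × ℂ)) (f : ℂ → ℂ × ℂ) (F : ℂ × ℂ → ℂ) : Prop :=
  DifferentiableOn ℂ F D ∧ MapsTo F D (ball 0 1) ∧ ∀ l ∈ ball (0 : ℂ) 1, F (f l) = l

/-- `f` has exactly one left inverse in `D`, as a function on `D`. -/
def HasUniqueLeftInverse (D : Set (ℂ × ℂ)) (f : ℂ → ℂ × ℂ) : Prop :=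
  ∃ F : ℂ × ℂ → ℂ, IsLeftInverse D f F ∧
    ∀ G : ℂ × ℂ → ℂ, IsLeftInverse D f G → EqOn G F D

/-- A bounded strictly convex domain: nonempty, open, bounded, convex, and with no nondegenerate
segment in the boundary. -/
def IsBoundedStrictlyConvexDomain (D : Set (ℂ × ℂ)) : Prop :=
  IsOpen D ∧ D.Nonempty ∧ Bornology.IsBounded D ∧ Convex ℝ D ∧
    ∀ x y : ℂ × ℂ, segment ℝ x y ⊆ frontier D → x = y

end

/-! A complete Reinhardt domain with `(1, 0)` on its boundary lies in `|z| < 1`, so the projection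
to `z` is a left inverse; only its uniqueness is at stake. Taylor expansion of a defining function
along `s ↦ (1, s)` leaves two cases (`IsLocalDefiningFunction.isFlat_or_hasFiniteContact`): near
`(1, 0)` the boundary approaches `|z| = 1` to infinite order in `|w|` (`IsFlat`), or recedes from it
at least like some power `|w| ^ k` (`HasFiniteContact`). The curve `ζ ↦ (1, ζ)` gives infinite type
in the first case; in the second the type is at most `k`.

In the flat case let `F` be a left inverse. Schwarz–Pick on vertical discs bounds `|F(z, w) - z|` by
`1 - |z|²`, and the maximum principle in `z` carries the bound from a circle `|z| = r`, with `1 - r`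
of size `|w| ^ (N + 1)`, to every fixed `z` in the disc. Hence `F(z, w) - z` vanishes to infinite
order at `w = 0`, so identically (`IsFlat.eqOn_fst`).

In the finite case `z + ε z ^ n w ^ k` is a second left inverse. For small `w` finite contact keeps
it in the disc. For the remaining `w`, where `D` may be unbounded, pseudoconvexity enters as
logarithmic convexity (`IsPseudoconvex.expPair_mem`) and bounds the monomial.

The example is `|z|² + e² exp(-1 / |w|²) < 1`. Its geodesics are unique because the midpoint of two
of them, normalized to agree at two points, is again extremal, which strict convexity forbids if
they stay apart near the unit circle (`IsUniformlyMidpointConvex.eqOn`). The Carathéodory distance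
is a supremum, so the argument uses nearly extremal functions, controlled by
`exists_lt_forall_mul_le_norm`. -/

/-! ### Möbius involutions and the Schwarz–Pick lemma -/

/-- The disc involution exchanging `0` and `a`. -/
noncomputable def mob (a z : ℂ) : ℂ := (a - z) / (1 - (starRingEnd ℂ) a * z)

theorem poincareDist_eq_artanh_mob (a b : ℂ) : poincareDist a b = Real.artanh ‖mob a b‖ := rfl

theorem one_sub_conj_mul_ne_zero {a z : ℂ} (ha : ‖a‖ < 1) (hz : ‖z‖ ≤ 1) :
    1 - (starRingEnd ℂ) a * z ≠ 0 := by
  intro h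
  have h1 : ‖(starRingEnd ℂ) a * z‖ = 1 := by rw [← sub_eq_zero.1 h]; simp
  rw [norm_mul, RCLike.norm_conj] at h1
  nlinarith [norm_nonneg a, norm_nonneg z]

theorem norm_sq_one_sub_conj_mul_sub (a z : ℂ) :
    ‖1 - (starRingEnd ℂ) a * z‖ ^ 2 - ‖a - z‖ ^ 2 = (1 - ‖a‖ ^ 2) * (1 - ‖z‖ ^ 2) := by
  simp only [← Complex.normSq_eq_norm_sq, Complex.normSq_apply, Complex.sub_re, Complex.sub_im,
    Complex.mul_re, Complex.mul_im, Complex.conj_re, Complex.conj_im, Complex.one_re,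
    Complex.one_im]
  ring

theorem one_sub_norm_mob_sq {a z : ℂ} (ha : ‖a‖ < 1) (hz : ‖z‖ ≤ 1) :
    1 - ‖mob a z‖ ^ 2 =
      (1 - ‖a‖ ^ 2) * (1 - ‖z‖ ^ 2) / ‖1 - (starRingEnd ℂ) a * z‖ ^ 2 := by
  have h : ‖1 - (starRingEnd ℂ) a * z‖ ≠ 0 := norm_ne_zero_iff.2 (one_sub_conj_mul_ne_zero ha hz)
  rw [← norm_sq_one_sub_conj_mul_sub, mob, norm_div, sub_div, div_self (pow_ne_zero 2 h), div_pow]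

theorem norm_mob_lt_one {a z : ℂ} (ha : ‖a‖ < 1) (hz : ‖z‖ < 1) : ‖mob a z‖ < 1 := by
  have h : 0 < ‖1 - (starRingEnd ℂ) a * z‖ :=
    norm_pos_iff.2 (one_sub_conj_mul_ne_zero ha hz.le)
  have h1 := one_sub_norm_mob_sq ha hz.le
  have h2 : 0 < 1 - ‖mob a z‖ ^ 2 := by
    rw [h1]
    have : 0 < 1 - ‖a‖ ^ 2 := by nlinarith [norm_nonneg a]
    have : 0 < 1 - ‖z‖ ^ 2 := by nlinarith [norm_nonneg z]
    positivity
  nlinarith [norm_nonneg (mob a z)]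

theorem norm_mob_comm (a b : ℂ) : ‖mob a b‖ = ‖mob b a‖ := by
  rw [mob, mob, norm_div, norm_div, norm_sub_rev a b]
  congr 1
  rw [← RCLike.norm_conj (K := ℂ)]
  simp [mul_comm]

theorem mob_zero_right (a : ℂ) : mob a 0 = a := by simp [mob]

theorem norm_mob_zero_left (z : ℂ) : ‖mob 0 z‖ = ‖z‖ := by simp [mob]

theorem mob_self (a : ℂ) : mob a a = 0 := by simp [mob]

theorem mob_eq_zero_iff {a z : ℂ} (ha : ‖a‖ < 1) (hz : ‖z‖ ≤ 1) : mob a z = 0 ↔ z = a := by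
  rw [mob, div_eq_zero_iff, or_iff_left (one_sub_conj_mul_ne_zero ha hz), sub_eq_zero, eq_comm]

theorem mob_mob {a z : ℂ} (ha : ‖a‖ < 1) (hz : ‖z‖ < 1) : mob a (mob a z) = z := by
  have h1 := one_sub_conj_mul_ne_zero ha hz.le
  have h2 := one_sub_conj_mul_ne_zero ha ha.le
  have h3 := one_sub_conj_mul_ne_zero ha (norm_mob_lt_one ha hz).le
  rw [mob, div_eq_iff h3]
  have h4 : mob a z * (1 - (starRingEnd ℂ) a * z) = a - z := div_mul_cancel₀ _ h1
  apply mul_right_cancel₀ h1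
  linear_combination (z * (starRingEnd ℂ) a - 1) * h4

theorem mapsTo_mob {a : ℂ} (ha : ‖a‖ < 1) : MapsTo (mob a) (ball 0 1) (ball 0 1) := by
  intro z hz
  rw [mem_ball_zero_iff] at *
  exact norm_mob_lt_one ha hz

theorem differentiableOn_mob {a : ℂ} (ha : ‖a‖ < 1) : DifferentiableOn ℂ (mob a) (ball 0 1) := by
  unfold mob
  apply DifferentiableOn.div (by fun_prop) (by fun_prop)
  intro z hz
  exact one_sub_conj_mul_ne_zero ha (mem_ball_zero_iff.1 hz).le

theorem bijOn_mob {a : ℂ} (ha : ‖a‖ < 1) : BijOn (mob a) (ball 0 1) (ball 0 1) :=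
  InvOn.bijOn ⟨fun _ hz => mob_mob ha (mem_ball_zero_iff.1 hz),
    fun _ hz => mob_mob ha (mem_ball_zero_iff.1 hz)⟩ (mapsTo_mob ha) (mapsTo_mob ha)

theorem isDiscAutomorphism_mob {a : ℂ} (ha : ‖a‖ < 1) : IsDiscAutomorphism (mob a) :=
  ⟨differentiableOn_mob ha, bijOn_mob ha⟩

theorem isDiscAutomorphism_const_mul {c : ℂ} (hc : ‖c‖ = 1) :
    IsDiscAutomorphism (fun z => c * z) := by
  have hc0 : c ≠ 0 := norm_ne_zero_iff.1 (by rw [hc]; exact one_ne_zero)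
  refine ⟨by fun_prop, ?_⟩
  refine InvOn.bijOn (f' := fun z => c⁻¹ * z) ⟨fun z _ => ?_, fun z _ => ?_⟩
    (fun z hz => ?_) (fun z hz => ?_)
  · simp [hc0]
  · simp [hc0]
  · simpa [hc] using hz
  · simpa [hc] using hz

theorem IsDiscAutomorphism.comp {a b : ℂ → ℂ} (ha : IsDiscAutomorphism a)
    (hb : IsDiscAutomorphism b) : IsDiscAutomorphism (a ∘ b) :=
  ⟨ha.1.comp hb.1 hb.2.mapsTo, ha.2.comp hb.2⟩

/-- The Schwarz–Pick lemma. -/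
theorem norm_mob_image_le {f : ℂ → ℂ} (hf : DifferentiableOn ℂ f (ball 0 1))
    (hm : MapsTo f (ball 0 1) (ball 0 1)) {a b : ℂ} (ha : ‖a‖ < 1) (hb : ‖b‖ < 1) :
    ‖mob (f a) (f b)‖ ≤ ‖mob a b‖ := by
  have hfa : ‖f a‖ < 1 := mem_ball_zero_iff.1 (hm (mem_ball_zero_iff.2 ha))
  have hd : DifferentiableOn ℂ (mob (f a) ∘ f ∘ mob a) (ball 0 1) :=
    (differentiableOn_mob hfa).comp (hf.comp (differentiableOn_mob ha) (mapsTo_mob ha))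
      (hm.comp (mapsTo_mob ha))
  have hmm : MapsTo (mob (f a) ∘ f ∘ mob a) (ball 0 1) (closedBall 0 1) :=
    ((mapsTo_mob hfa).comp (hm.comp (mapsTo_mob ha))).mono_right ball_subset_closedBall
  have := Complex.norm_le_norm_of_mapsTo_ball hd hmm (by simp [mob_zero_right, mob_self])
    (norm_mob_lt_one ha hb)
  simpa [mob_mob ha hb] using this

/-- Schwarz–Pick for maps into the closed disc, in polynomial form. -/
theorem one_sub_sq_mul_le_of_mapsTo_closedBall {f : ℂ → ℂ} (hf : DifferentiableOn ℂ f (ball 0 1))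
    (hm : MapsTo f (ball 0 1) (closedBall 0 1)) {a b : ℂ} (ha : ‖a‖ < 1) (hb : ‖b‖ < 1) :
    (1 - ‖mob a b‖ ^ 2) * ‖1 - (starRingEnd ℂ) (f a) * f b‖ ^ 2 ≤
      (1 - ‖f a‖ ^ 2) * (1 - ‖f b‖ ^ 2) := by
  -- `t f` maps into the open disc, where Schwarz–Pick applies; the polynomial form has no
  -- denominator and survives `t → 1`.
  have key : ∀ t : ℝ, t ∈ Ioo (0 : ℝ) 1 →
      (1 - ‖mob a b‖ ^ 2) * ‖1 - (starRingEnd ℂ) ((t : ℂ) * f a) * ((t : ℂ) * f b)‖ ^ 2 ≤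
      (1 - ‖(t : ℂ) * f a‖ ^ 2) * (1 - ‖(t : ℂ) * f b‖ ^ 2) := by
    intro t ht
    have hmt : ∀ z : ℂ, ‖z‖ < 1 → ‖(t : ℂ) * f z‖ < 1 := by
      intro z hz
      have h1 := mem_closedBall_zero_iff.1 (hm (mem_ball_zero_iff.2 hz))
      rw [norm_mul, Complex.norm_real, Real.norm_of_nonneg ht.1.le]
      nlinarith [ht.1, ht.2, norm_nonneg (f z)]
    have hsp := norm_mob_image_le (f := fun z => (t : ℂ) * f z) (hf.const_mul _)
      (fun z hz => mem_ball_zero_iff.2 (hmt z (mem_ball_zero_iff.1 hz))) ha hb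
    have h1 := one_sub_norm_mob_sq (hmt a ha) (hmt b hb).le
    have h2 : 0 < ‖1 - (starRingEnd ℂ) ((t : ℂ) * f a) * ((t : ℂ) * f b)‖ :=
      norm_pos_iff.2 (one_sub_conj_mul_ne_zero (hmt a ha) (hmt b hb).le)
    have h3 : 1 - ‖mob a b‖ ^ 2 ≤ 1 - ‖mob ((t : ℂ) * f a) ((t : ℂ) * f b)‖ ^ 2 := by
      have := pow_le_pow_left₀ (norm_nonneg _) hsp 2
      linarith
    rw [h1, le_div_iff₀ (by positivity)] at h3
    exact h3
  have hl : Tendsto (fun t : ℝ =>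
      (1 - ‖mob a b‖ ^ 2) * ‖1 - (starRingEnd ℂ) ((t : ℂ) * f a) * ((t : ℂ) * f b)‖ ^ 2)
      (𝓝[<] 1) (𝓝 ((1 - ‖mob a b‖ ^ 2) * ‖1 - (starRingEnd ℂ) (f a) * f b‖ ^ 2)) := by
    refine tendsto_nhdsWithin_of_tendsto_nhds ?_
    have : Continuous (fun t : ℝ =>
      (1 - ‖mob a b‖ ^ 2) * ‖1 - (starRingEnd ℂ) ((t : ℂ) * f a) * ((t : ℂ) * f b)‖ ^ 2) := by
      fun_prop
    simpa using this.tendsto 1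
  have hr : Tendsto (fun t : ℝ => (1 - ‖(t : ℂ) * f a‖ ^ 2) * (1 - ‖(t : ℂ) * f b‖ ^ 2))
      (𝓝[<] 1) (𝓝 ((1 - ‖f a‖ ^ 2) * (1 - ‖f b‖ ^ 2))) := by
    refine tendsto_nhdsWithin_of_tendsto_nhds ?_
    have : Continuous (fun t : ℝ => (1 - ‖(t : ℂ) * f a‖ ^ 2) * (1 - ‖(t : ℂ) * f b‖ ^ 2)) := by
      fun_prop
    simpa using this.tendsto 1
  exact le_of_tendsto_of_tendsto hl hr
    (eventually_of_mem (Ioo_mem_nhdsLT (zero_lt_one)) fun t ht => key t ht)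

/-! ### Carathéodory distance, left inverses and complete Reinhardt domains -/

theorem le_caratheodoryDist {D : Set (ℂ × ℂ)} {F : ℂ × ℂ → ℂ} (hF : DifferentiableOn ℂ F D)
    (hm : MapsTo F D (ball 0 1)) (p q : ℂ × ℂ) :
    ENNReal.ofReal (poincareDist (F p) (F q)) ≤ caratheodoryDist D p q :=
  le_iSup₂_of_le F ⟨hF, hm⟩ le_rfl

theorem caratheodoryDist_image_le {D : Set (ℂ × ℂ)} {f : ℂ → ℂ × ℂ}
    (hf : DifferentiableOn ℂ f (ball 0 1)) (hm : MapsTo f (ball 0 1) D) {a b : ℂ}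
    (ha : ‖a‖ < 1) (hb : ‖b‖ < 1) :
    caratheodoryDist D (f a) (f b) ≤ ENNReal.ofReal (poincareDist a b) := by
  refine iSup₂_le fun F hF => ENNReal.ofReal_le_ofReal ?_
  refine Real.artanh_le_artanh ?_ ?_
    (norm_mob_image_le (f := F ∘ f) (hF.1.comp hf hm) (hF.2.comp hm) ha hb)
  · exact lt_of_lt_of_le (by norm_num) (norm_nonneg _)
  · exact norm_mob_lt_one ha hb

theorem IsLeftInverse.isComplexGeodesic {D : Set (ℂ × ℂ)} {f : ℂ → ℂ × ℂ} {F : ℂ × ℂ → ℂ}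
    (hF : IsLeftInverse D f F) (hf : DifferentiableOn ℂ f (ball 0 1))
    (hm : MapsTo f (ball 0 1) D) : IsComplexGeodesic D f := by
  have h0 : (0 : ℂ) ∈ ball (0 : ℂ) 1 := by simp
  have h1 : (1 / 2 : ℂ) ∈ ball (0 : ℂ) 1 := by simp; norm_num
  refine ⟨hf, hm, 0, h0, 1 / 2, h1, by norm_num, le_antisymm
    (caratheodoryDist_image_le hf hm (by simp) (by simpa using h1)) ?_⟩
  have := le_caratheodoryDist hF.1 hF.2.1 (f 0) (f (1 / 2))
  rwa [hF.2.2 0 h0, hF.2.2 _ h1] at this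

section Reinhardt

variable {D : Set (ℂ × ℂ)}

theorem IsCompleteReinhardt.mem_of_norm_le (hR : IsCompleteReinhardt D) {p q : ℂ × ℂ}
    (hp : p ∈ D) (h1 : ‖q.1‖ ≤ ‖p.1‖) (h2 : ‖q.2‖ ≤ ‖p.2‖) : q ∈ D := by
  have key : ∀ a b : ℂ, ‖b‖ ≤ ‖a‖ → ∃ c : ℂ, ‖c‖ ≤ 1 ∧ c * a = b := by
    intro a b h
    rcases eq_or_ne a 0 with rfl | ha
    · exact ⟨0, by simp, by simp at h; simp [h]⟩
    · refine ⟨b / a, ?_, by field_simp⟩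
      rw [norm_div]
      exact div_le_one_of_le₀ h (norm_nonneg _)
  obtain ⟨c, hc, hc'⟩ := key _ _ h1
  obtain ⟨d, hd, hd'⟩ := key _ _ h2
  have := hR p hp c d hc hd
  rwa [hc', hd'] at this

theorem IsCompleteReinhardt.mem_congr (hR : IsCompleteReinhardt D) {p q : ℂ × ℂ}
    (h1 : ‖p.1‖ = ‖q.1‖) (h2 : ‖p.2‖ = ‖q.2‖) : p ∈ D ↔ q ∈ D :=
  ⟨fun h => hR.mem_of_norm_le h h1.ge h2.ge, fun h => hR.mem_of_norm_le h h1.le h2.le⟩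

theorem IsCompleteReinhardt.norm_fst_lt_one (hR : IsCompleteReinhardt D) (ho : IsOpen D)
    (hfr : ((1, 0) : ℂ × ℂ) ∈ frontier D) {p : ℂ × ℂ} (hp : p ∈ D) : ‖p.1‖ < 1 := by
  by_contra! h
  have : ((1, 0) : ℂ × ℂ) ∈ D := hR.mem_of_norm_le hp (by simpa using h) (by simp)
  rw [ho.frontier_eq] at hfr
  exact hfr.2 this

theorem IsCompleteReinhardt.disc_mem (hR : IsCompleteReinhardt D)
    (hfr : ((1, 0) : ℂ × ℂ) ∈ frontier D) {l : ℂ} (hl : ‖l‖ < 1) : ((l, 0) : ℂ × ℂ) ∈ D := by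
  have h1 : {p : ℂ × ℂ | ‖l‖ < ‖p.1‖} ∈ 𝓝 ((1, 0) : ℂ × ℂ) :=
    (isOpen_lt continuous_const (by fun_prop)).mem_nhds (by simpa using hl)
  obtain ⟨p, hp1, hp2⟩ := mem_closure_iff_nhds.1 (frontier_subset_closure hfr) _ h1
  exact hR.mem_of_norm_le hp2 (le_of_lt hp1) (by simp)

theorem isLeftInverse_fst (h : ∀ p ∈ D, ‖p.1‖ < 1) :
    IsLeftInverse D (fun l : ℂ => (l, 0)) Prod.fst :=
  ⟨differentiableOn_fst, fun p hp => mem_ball_zero_iff.2 (h p hp), fun _ _ => rfl⟩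

theorem isComplexGeodesic_disc (hR : IsCompleteReinhardt D) (ho : IsOpen D)
    (hfr : ((1, 0) : ℂ × ℂ) ∈ frontier D) : IsComplexGeodesic D (fun l : ℂ => (l, 0)) :=
  (isLeftInverse_fst fun _ hp => hR.norm_fst_lt_one ho hfr hp).isComplexGeodesic
    (by fun_prop) fun _ hl => hR.disc_mem hfr (mem_ball_zero_iff.1 hl)

end Reinhardt

/-! ### Comparison of vanishing orders -/

theorem le_of_eventually_mul_pow_le_mul_pow {c C : ℝ} (hc : 0 < c) {m n : ℕ}
    (h : ∀ᶠ r : ℝ in 𝓝[>] 0, c * r ^ n ≤ C * r ^ m) : m ≤ n := by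
  by_contra! hlt
  have h1 : ∀ᶠ r : ℝ in 𝓝[>] 0, c ≤ C * r ^ (m - n) := by
    filter_upwards [h, self_mem_nhdsWithin] with r hr hr0
    have hr0 : 0 < r := hr0
    have : r ^ m = r ^ (m - n) * r ^ n := by rw [← pow_add]; congr 1; omega
    rw [this, ← mul_assoc] at hr
    exact le_of_mul_le_mul_right hr (by positivity)
  have h2 : Tendsto (fun r : ℝ => C * r ^ (m - n)) (𝓝[>] 0) (𝓝 0) := by
    refine tendsto_nhdsWithin_of_tendsto_nhds ?_
    have : Continuous fun r : ℝ => C * r ^ (m - n) := by fun_prop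
    have h3 := this.tendsto 0
    rwa [zero_pow (by omega), mul_zero] at h3
  exact absurd (ge_of_tendsto h2 h1) (not_le.2 hc)

theorem AnalyticAt.exists_pow_mul_le_norm {E : Type*} [NormedAddCommGroup E] [NormedSpace ℂ E]
    {g : ℂ → E} (hg : AnalyticAt ℂ g 0)
    (hne : ¬ ∀ᶠ z in 𝓝 0, g z = 0) : ∃ n : ℕ, ∃ α : E, α ≠ 0 ∧
      (∀ᶠ z in 𝓝 0, ‖g z - z ^ n • α‖ ≤ ‖α‖ / 2 * ‖z‖ ^ n) := by
  obtain ⟨n, h, hh, h0, hgh⟩ := hg.exists_eventuallyEq_pow_smul_nonzero_iff.2 hne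
  refine ⟨n, h 0, h0, ?_⟩
  have h1 : ∀ᶠ z in 𝓝 0, ‖h z - h 0‖ < ‖h 0‖ / 2 := by
    have : Tendsto (fun z => ‖h z - h 0‖) (𝓝 0) (𝓝 ‖h 0 - h 0‖) :=
      (hh.continuousAt.tendsto.sub_const (h 0)).norm
    rw [sub_self, norm_zero] at this
    exact this.eventually (gt_mem_nhds (by positivity))
  filter_upwards [hgh, h1] with z hz hz1
  rw [hz, sub_zero, ← smul_sub, norm_smul, norm_pow, mul_comm]
  exact mul_le_mul_of_nonneg_right hz1.le (by positivity)

theorem AnalyticAt.eventually_eq_zero_of_forall_isBigO {g : ℂ → ℂ} (hg : AnalyticAt ℂ g 0)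
    (h : ∀ N : ℕ, ∃ C : ℝ, ∀ᶠ z in 𝓝 0, ‖g z‖ ≤ C * ‖z‖ ^ N) : ∀ᶠ z in 𝓝 0, g z = 0 := by
  by_contra hne
  obtain ⟨n, α, hα, hn⟩ := hg.exists_pow_mul_le_norm hne
  obtain ⟨C, hC⟩ := h (n + 1)
  have hr : Tendsto (fun r : ℝ => (r : ℂ)) (𝓝[>] 0) (𝓝 0) := by
    refine tendsto_nhdsWithin_of_tendsto_nhds ?_
    simpa using Complex.continuous_ofReal.tendsto 0
  have : n + 1 ≤ n := by
    refine le_of_eventually_mul_pow_le_mul_pow (c := ‖α‖ / 2) (C := C) (by positivity) ?_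
    filter_upwards [hr.eventually hn, hr.eventually hC, self_mem_nhdsWithin] with r h1 h2 h3
    have h3 : 0 < r := h3
    simp only [Complex.norm_real, Real.norm_of_nonneg h3.le] at h1 h2
    have h4 := norm_sub_norm_le ((r : ℂ) ^ n • α) (((r : ℂ) ^ n • α) - g r)
    rw [sub_sub_cancel, norm_smul, norm_pow, Complex.norm_real, Real.norm_of_nonneg h3.le,
      norm_sub_rev] at h4
    linarith
  omega

/-! ### Flat boundary: the projection is the only left inverse -/

/-- Near `(1, 0)` the domain `D` contains the points whose distance to the circle `|z| = 1` exceeds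
a multiple of `|w| ^ (N + 1)`, for every `N`. -/
def IsFlat (D : Set (ℂ × ℂ)) : Prop :=
  ∀ N : ℕ, ∃ C : ℝ, 0 < C ∧ ∃ δ : ℝ, 0 < δ ∧ ∀ s x : ℝ, 0 ≤ s → s < δ → 0 ≤ x →
    x < 1 - C * s ^ (N + 1) → ((x, s) : ℂ × ℂ) ∈ D

section

variable {D : Set (ℂ × ℂ)} {F : ℂ × ℂ → ℂ}

/-- Schwarz–Pick on the vertical disc `ζ ↦ (z, 2ζw)`, between `ζ = 0`, where `F` equals `z`, and `ζ
= 1/2`. It gives `|F - z| ≤ ½ |1 - z̄ F| ≤ ½ ((1 - |z|²) + |F - z|)`, and the last term is absorbed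
on the left. -/
theorem IsLeftInverse.norm_sub_fst_le_of_mem (hR : IsCompleteReinhardt D)
    (hF : IsLeftInverse D (fun l : ℂ => (l, 0)) F) {z w : ℂ} (hz : ‖z‖ < 1)
    (hD : ((z, 2 * w) : ℂ × ℂ) ∈ D) : ‖F (z, w) - z‖ ≤ 1 - ‖z‖ ^ 2 := by
  have hm : MapsTo (fun ζ : ℂ => ((z, ζ * (2 * w)) : ℂ × ℂ)) (ball 0 1) D := by
    intro ζ hζ
    refine hR.mem_of_norm_le hD le_rfl ?_
    rw [norm_mul]
    exact mul_le_of_le_one_left (norm_nonneg _) (mem_ball_zero_iff.1 hζ).le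
  have hd : DifferentiableOn ℂ (fun ζ : ℂ => F (z, ζ * (2 * w))) (ball 0 1) :=
    hF.1.comp (by fun_prop) hm
  have h1 := norm_mob_image_le hd (hF.2.1.comp hm) (a := 0) (b := 1 / 2) (by simp)
    (by norm_num)
  have hF0 : F (z, 0) = z := hF.2.2 z (mem_ball_zero_iff.2 hz)
  have hw : (1 / 2 : ℂ) * (2 * w) = w := by ring
  rw [norm_mob_zero_left, hw, zero_mul, hF0, mob, norm_div] at h1
  have hFw : ‖F (z, w)‖ < 1 := by
    refine mem_ball_zero_iff.1 (hF.2.1 (hR.mem_of_norm_le hD le_rfl ?_))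
    simp only [norm_mul, Complex.norm_ofNat]
    linarith [norm_nonneg w]
  rw [div_le_iff₀ (norm_pos_iff.2 (one_sub_conj_mul_ne_zero hz hFw.le)), norm_sub_rev] at h1
  have h2 : (1 : ℂ) - (starRingEnd ℂ) z * F (z, w) =
      ((1 - ‖z‖ ^ 2 : ℝ) : ℂ) - (starRingEnd ℂ) z * (F (z, w) - z) := by
    push_cast
    rw [← Complex.conj_mul']
    ring
  have h3 : ‖(1 : ℂ) - (starRingEnd ℂ) z * F (z, w)‖ ≤ (1 - ‖z‖ ^ 2) + ‖F (z, w) - z‖ := by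
    rw [h2]
    refine (norm_sub_le _ _).trans (add_le_add ?_ ?_)
    · rw [Complex.norm_real, Real.norm_of_nonneg]
      nlinarith [norm_nonneg z]
    · rw [norm_mul, RCLike.norm_conj]
      exact mul_le_of_le_one_left (norm_nonneg _) hz.le
  norm_num at h1
  linarith

/-- The previous bound is good only for `|z|` near `1`; the maximum principle in `z` transports it
from `|z| = r` to the whole disc `|z| ≤ r`. -/
theorem IsLeftInverse.norm_sub_fst_le (hR : IsCompleteReinhardt D)
    (hF : IsLeftInverse D (fun l : ℂ => (l, 0)) F) {z w : ℂ} {r : ℝ} (hr0 : 0 < r) (hr : r < 1)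
    (hz : ‖z‖ ≤ r) (hD : (((r : ℂ), 2 * w) : ℂ × ℂ) ∈ D) : ‖F (z, w) - z‖ ≤ 1 - r ^ 2 := by
  have hnr : ‖(r : ℂ)‖ = r := by rw [Complex.norm_real, Real.norm_of_nonneg hr0.le]
  have hcl : closure (ball (0 : ℂ) r) = closedBall 0 r := closure_ball _ hr0.ne'
  have hm : MapsTo (fun z : ℂ => ((z, w) : ℂ × ℂ)) (closedBall 0 r) D := by
    intro z hz
    refine hR.mem_of_norm_le hD (hnr.symm ▸ mem_closedBall_zero_iff.1 hz) ?_
    simp only [norm_mul, Complex.norm_ofNat]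
    linarith [norm_nonneg w]
  refine Complex.norm_le_of_forall_mem_frontier_norm_le (f := fun z => F (z, w) - z)
    (isBounded_ball (x := 0) (r := r))
    (DifferentiableOn.diffContOnCl ?_) ?_ (z := z) (by rw [hcl]; simpa using hz)
  · rw [hcl]
    exact (hF.1.comp (by fun_prop) hm).sub differentiableOn_id
  · intro ξ hξ
    rw [frontier_ball _ hr0.ne', mem_sphere_zero_iff_norm] at hξ
    have := hF.norm_sub_fst_le_of_mem hR (z := ξ) (w := w) (by rwa [hξ])
      ((hR.mem_congr (p := (ξ, 2 * w)) (q := ((r : ℂ), 2 * w)) (by simp only [hnr, hξ]) rfl).2 hD)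
    rwa [hξ] at this

/-- On a complete Reinhardt domain which is flat at `(1, 0)`, the projection is the only left
inverse of the disc in the first coordinate axis. -/
theorem IsFlat.eqOn_fst (hflat : IsFlat D) (ho : IsOpen D) (hR : IsCompleteReinhardt D)
    (hD1 : ∀ p ∈ D, ‖p.1‖ < 1)
    (hF : IsLeftInverse D (fun l : ℂ => (l, 0)) F) : EqOn F Prod.fst D := by
  rintro ⟨z, w₀⟩ hzw
  have hz : ‖z‖ < 1 := hD1 _ hzw
  set V : Set ℂ := {w | ((z, w) : ℂ × ℂ) ∈ D} with hV
  have hVo : IsOpen V := ho.preimage (by fun_prop : Continuous fun w : ℂ => ((z, w) : ℂ × ℂ))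
  have hV0 : (0 : ℂ) ∈ V := hR.mem_of_norm_le hzw le_rfl (by simp)
  have hVs : StarConvex ℝ (0 : ℂ) V := by
    rw [starConvex_zero_iff]
    intro w hw a ha ha1
    refine hR.mem_of_norm_le hw le_rfl ?_
    simp only [norm_smul, Real.norm_of_nonneg ha]
    exact mul_le_of_le_one_left (norm_nonneg _) ha1
  have hgd : DifferentiableOn ℂ (fun w => F (z, w) - z) V :=
    (hF.1.comp (f := fun w : ℂ => ((z, w) : ℂ × ℂ)) (by fun_prop) fun w hw => hw).sub (differentiableOn_const z)
  have hga : AnalyticOnNhd ℂ (fun w => F (z, w) - z) V := hgd.analyticOnNhd hVo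
  have hev : ∀ᶠ w in 𝓝 (0 : ℂ), F (z, w) - z = 0 := by
    refine (hga 0 hV0).eventually_eq_zero_of_forall_isBigO fun N => ?_
    obtain ⟨C, hC, δ, hδ, hCδ⟩ := hflat N
    refine ⟨4 * C * 2 ^ (N + 1), ?_⟩
    have ht : Tendsto (fun w : ℂ => 1 - 2 * C * (2 * ‖w‖) ^ (N + 1)) (𝓝 0) (𝓝 1) := by
      have : Continuous fun w : ℂ => 1 - 2 * C * (2 * ‖w‖) ^ (N + 1) := by fun_prop
      simpa using this.tendsto 0
    have hn : Tendsto (fun w : ℂ => ‖w‖) (𝓝 0) (𝓝 0) := by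
      simpa using (continuous_norm (E := ℂ)).tendsto 0
    filter_upwards [ht.eventually (lt_mem_nhds hz), ht.eventually (lt_mem_nhds zero_lt_one),
      hn.eventually (gt_mem_nhds (half_pos hδ)), hn.eventually (gt_mem_nhds zero_lt_one)]
      with w h1 h2 h3 h4
    rcases eq_or_ne w 0 with rfl | hw
    · have : F (z, 0) = z := hF.2.2 z (mem_ball_zero_iff.2 hz)
      simp only [this, sub_self, norm_zero]
      positivity
    have hw0 : 0 < ‖w‖ := norm_pos_iff.2 hw
    -- Flatness is used at height `2‖w‖`, as `norm_sub_fst_le` needs `(r, 2w) ∈ D`; the extra factor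
    -- `2` on `C` makes the required inequality strict.
    set r := 1 - 2 * C * (2 * ‖w‖) ^ (N + 1) with hr
    have hpos : 0 < C * (2 * ‖w‖) ^ (N + 1) := by positivity
    have hmem := hCδ (2 * ‖w‖) r (by positivity) (by linarith) h2.le (by linarith)
    have hmem' : (((r : ℂ), 2 * w) : ℂ × ℂ) ∈ D :=
      (hR.mem_congr (p := ((r : ℂ), 2 * w)) (q := ((r : ℂ), ((2 * ‖w‖ : ℝ) : ℂ))) rfl (by simp)).2 hmem
    refine (hF.norm_sub_fst_le hR h2 (by linarith) h1.le hmem').trans ?_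
    have h5 : (2 * ‖w‖) ^ (N + 1) ≤ 2 ^ (N + 1) * ‖w‖ ^ N := by
      rw [mul_pow, pow_succ ‖w‖]
      have : ‖w‖ ^ N * ‖w‖ ≤ ‖w‖ ^ N := mul_le_of_le_one_right (by positivity) h4.le
      gcongr
    calc 1 - r ^ 2 ≤ 2 * (1 - r) := by nlinarith [sq_nonneg (1 - r)]
      _ = 4 * C * (2 * ‖w‖) ^ (N + 1) := by rw [hr]; ring
      _ ≤ 4 * C * (2 ^ (N + 1) * ‖w‖ ^ N) := by gcongr
      _ = _ := by ring
  -- The fibre over `z` is star-shaped about `0`, so the identity theorem reaches all of it.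
  have := hga.eqOn_zero_of_preconnected_of_eventuallyEq_zero
    (hVs.isPathConnected hV0).isConnected.isPreconnected hV0 hev
  exact sub_eq_zero.1 (this hzw)

end

/-! ### Smooth boundary: flatness or finite contact -/

/-- Either the whole Taylor series at `0` vanishes, or its first nonzero term dominates.
Nonnegativity of `m` makes that coefficient positive, and `m 0 = 0` gives `k ≥ 1`. -/
theorem ContDiffOn.isBigO_or_exists_mul_pow_le {m : ℝ → ℝ} {η : ℝ} (hη : 0 < η)
    (hm : ContDiffOn ℝ ∞ m (Icc (-η) η)) (hnn : ∀ s ∈ Icc (-η) η, 0 ≤ m s) (hm0 : m 0 = 0) :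
    (∀ N : ℕ, ∀ᶠ s in 𝓝 (0 : ℝ), m s ≤ |s| ^ N) ∨
      ∃ k : ℕ, 1 ≤ k ∧ ∃ c : ℝ, 0 < c ∧ ∀ᶠ s in 𝓝[>] (0 : ℝ), c * s ^ k ≤ m s := by
  set S := Icc (-η) η with hS
  have hSn : S ∈ 𝓝 (0 : ℝ) := Icc_mem_nhds (by linarith) hη
  have h0S : (0 : ℝ) ∈ S := mem_of_mem_nhds hSn
  have hT : ∀ n : ℕ, (fun x ↦ m x - taylorWithinEval m n S 0 x) =o[𝓝 0] fun x ↦ x ^ n := by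
    intro n
    have := taylor_isLittleO (convex_Icc (-η) η) h0S (n := n) (hm.of_le (mod_cast le_top))
    rwa [nhdsWithin_eq_nhds.2 hSn, funext fun x : ℝ => congrArg (· ^ n) (sub_zero x)] at this
  by_cases hall : ∀ n : ℕ, iteratedDerivWithin n m S 0 = 0
  · left
    intro N
    have h1 := (hT N).def (c := 1) one_pos
    filter_upwards [h1] with s hs
    have h2 : taylorWithinEval m N S 0 s = 0 := by
      rw [taylor_within_apply]
      exact Finset.sum_eq_zero fun i _ => by rw [hall i, smul_zero]
    rw [h2, sub_zero, one_mul, norm_pow] at hs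
    exact (le_abs_self _).trans hs
  · right
    push Not at hall
    classical
    let k := Nat.find hall
    have hk : iteratedDerivWithin k m S 0 ≠ 0 := Nat.find_spec hall
    have hlt : ∀ j < k, iteratedDerivWithin j m S 0 = 0 := fun j hj => by
      simpa using Nat.find_min hall hj
    set a := iteratedDerivWithin k m S 0 with ha
    have hk1 : 1 ≤ k := by
      rw [Nat.one_le_iff_ne_zero]
      intro h
      apply hk
      rw [ha, h, iteratedDerivWithin_zero, hm0]
    have hf : (0 : ℝ) < k.factorial := by positivity
    set b := a / k.factorial with hb
    have hTk : ∀ s, taylorWithinEval m k S 0 s = b * s ^ k := by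
      intro s
      rw [taylor_within_apply, Finset.sum_eq_single k]
      · rw [sub_zero, smul_eq_mul, ← ha, hb]
        field_simp
      · intro j hj hjk
        rw [hlt j (by have := Finset.mem_range.1 hj; omega), smul_zero]
      · simp
    have hb0 : b ≠ 0 := div_ne_zero hk hf.ne'
    have h1 := (hT k).def (c := |b| / 2) (by positivity)
    have h2 : ∀ᶠ s in 𝓝[>] (0 : ℝ), |m s - b * s ^ k| ≤ |b| / 2 * s ^ k := by
      filter_upwards [h1.filter_mono nhdsWithin_le_nhds, self_mem_nhdsWithin] with s hs hs0
      have hs0 : 0 < s := hs0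
      rwa [hTk, Real.norm_eq_abs, Real.norm_of_nonneg (by positivity)] at hs
    have hbpos : 0 < b := by
      by_contra! hneg
      have hneg : b < 0 := lt_of_le_of_ne hneg hb0
      obtain ⟨s, hs, hsS, hs0⟩ :=
        (h2.and (((eventually_mem_set.2 hSn).filter_mono nhdsWithin_le_nhds).and
          (eventually_mem_set.2 (self_mem_nhdsWithin (a := (0 : ℝ)) (s := Ioi 0))))).exists
      have hs0 : 0 < s := hs0
      have := hnn s hsS
      have h3 := (abs_le.1 hs).2
      rw [abs_of_neg hneg] at h3
      nlinarith [pow_pos hs0 k]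
    refine ⟨k, hk1, b / 2, by positivity, ?_⟩
    filter_upwards [h2] with s hs
    have h3 := (abs_le.1 hs).1
    rw [abs_of_pos hbpos] at h3
    linarith

/-- The domain `D` stays, near the first coordinate axis, at a distance from the circle `|z| = 1`
which is at least a multiple of some power of `|w|`. -/
def HasFiniteContact (D : Set (ℂ × ℂ)) : Prop :=
  ∃ k : ℕ, 1 ≤ k ∧ ∃ c : ℝ, 0 < c ∧ ∃ δ : ℝ, 0 < δ ∧ ∀ z w : ℂ, ‖w‖ < δ →
    ((z, w) : ℂ × ℂ) ∈ D → ‖z‖ < 1 - c * ‖w‖ ^ k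

section

variable {D U : Set (ℂ × ℂ)} {ρ : ℂ × ℂ → ℝ}

theorem IsLocalDefiningFunction.differentiableAt {p : ℂ × ℂ}
    (h : IsLocalDefiningFunction D p U ρ) {q : ℂ × ℂ} (hq : q ∈ U) : DifferentiableAt ℝ ρ q :=
  (h.2.2.1.contDiffAt (h.1.mem_nhds hq)).differentiableAt (by simp)

theorem IsLocalDefiningFunction.hasDerivAt_line {p : ℂ × ℂ}
    (h : IsLocalDefiningFunction D p U ρ) {q v : ℂ × ℂ} {t : ℝ} (hq : q + t • v ∈ U) :
    HasDerivAt (fun t : ℝ => ρ (q + t • v)) (fderiv ℝ ρ (q + t • v) v) t := by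
  have h1 : HasDerivAt (fun t : ℝ => q + t • v) v t := by
    simpa using ((hasDerivAt_id t).smul_const v).const_add q
  exact (h.differentiableAt hq).hasFDerivAt.comp_hasDerivAt t h1

theorem IsLocalDefiningFunction.nonneg_of_one_le_norm
    (h : IsLocalDefiningFunction D (1, 0) U ρ) (hD1 : ∀ p ∈ D, ‖p.1‖ < 1) {q : ℂ × ℂ} (hq : q ∈ U) (h1 : 1 ≤ ‖q.1‖) :
    0 ≤ ρ q := by
  by_contra! hlt
  exact absurd (hD1 q ((h.2.2.2.1 q hq).2 hlt)) (not_lt.2 h1)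

theorem IsLocalDefiningFunction.apply_eq_zero (h : IsLocalDefiningFunction D (1, 0) U ρ)
    (hD1 : ∀ p ∈ D, ‖p.1‖ < 1) (hfr : ((1, 0) : ℂ × ℂ) ∈ frontier D) :
    ρ (1, 0) = 0 := by
  refine le_antisymm ?_ (h.nonneg_of_one_le_norm hD1 h.2.1 (by simp))
  by_contra! hlt
  have h1 : ∀ᶠ q in 𝓝 ((1, 0) : ℂ × ℂ), 0 < ρ q :=
    (h.differentiableAt h.2.1).continuousAt.eventually (lt_mem_nhds hlt)
  obtain ⟨q, hq, hqD⟩ := mem_closure_iff_nhds.1 (frontier_subset_closure hfr) _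
    (h1.and (h.1.mem_nhds h.2.1))
  exact absurd ((h.2.2.2.1 q hq.2).1 hqD) (not_lt.2 hq.1.le)

/-- Since `ρ ≥ 0` where `|z| ≥ 1`, the restriction of `ρ` to the real hyperplane `Re z = 1` has a
local minimum at `(1, 0)`. The differential therefore kills that hyperplane, and being nonzero it
must be positive on the outward normal. -/
theorem IsLocalDefiningFunction.fderiv_one_zero_pos (h : IsLocalDefiningFunction D (1, 0) U ρ)
    (hD1 : ∀ p ∈ D, ‖p.1‖ < 1) (hfr : ((1, 0) : ℂ × ℂ) ∈ frontier D) :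
    0 < fderiv ℝ ρ (1, 0) (1, 0) := by
  have hp := h.apply_eq_zero hD1 hfr
  have hd : ∀ v : ℂ × ℂ, HasDerivAt (fun t : ℝ => ρ ((1, 0) + t • v)) (fderiv ℝ ρ (1, 0) v) 0 := by
    intro v
    have := h.hasDerivAt_line (q := (1, 0)) (v := v) (t := 0) (by simpa using h.2.1)
    simpa using this
  have hU : ∀ v : ℂ × ℂ, ∀ᶠ t in 𝓝 (0 : ℝ), ((1, 0) : ℂ × ℂ) + t • v ∈ U := by
    intro v
    have h1 : Continuous fun t : ℝ => ((1, 0) : ℂ × ℂ) + t • v := by fun_prop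
    exact h1.continuousAt.eventually_mem (h.1.mem_nhds (by simpa using h.2.1))
  have hzero : ∀ v : ℂ × ℂ, v.1.re = 0 → fderiv ℝ ρ (1, 0) v = 0 := by
    intro v hv
    refine IsLocalMin.hasDerivAt_eq_zero ?_ (hd v)
    filter_upwards [hU v] with t ht
    rw [zero_smul, add_zero, hp]
    refine h.nonneg_of_one_le_norm hD1 ht ?_
    have : (((1, 0) : ℂ × ℂ) + t • v).1.re = 1 := by simp [hv]
    rw [← this]
    exact Complex.re_le_norm _
  have hnn : 0 ≤ fderiv ℝ ρ (1, 0) (1, 0) := by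
    refine ge_of_tendsto (hd (1, 0)).tendsto_slope_zero_right ?_
    filter_upwards [(hU (1, 0)).filter_mono nhdsWithin_le_nhds, self_mem_nhdsWithin] with t ht ht0
    have ht0 : 0 < t := ht0
    simp only [zero_add, zero_smul, add_zero, hp, sub_zero]
    refine smul_nonneg (by positivity) (h.nonneg_of_one_le_norm hD1 ht ?_)
    have : (((1, 0) : ℂ × ℂ) + t • ((1, 0) : ℂ × ℂ)).1 = ((1 + t : ℝ) : ℂ) := by
      simp
    rw [this, Complex.norm_real, Real.norm_of_nonneg (by positivity)]
    linarith
  refine lt_of_le_of_ne hnn fun h0 => h.2.2.2.2 _ h.2.1 hp ?_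
  refine ContinuousLinearMap.ext fun v => ?_
  have hv : v = v.1.re • ((1, 0) : ℂ × ℂ) + (v - v.1.re • ((1, 0) : ℂ × ℂ)) := by abel
  rw [hv, map_add, map_smul, ← h0, hzero (v - v.1.re • ((1, 0) : ℂ × ℂ)) (by simp)]
  simp

/-- Near `(1, 0)` a defining function grows in the direction `(1, 0)` at a rate bounded from above
and below. -/
theorem IsLocalDefiningFunction.exists_normal_growth (h : IsLocalDefiningFunction D (1, 0) U ρ)
    (hD1 : ∀ p ∈ D, ‖p.1‖ < 1) (hfr : ((1, 0) : ℂ × ℂ) ∈ frontier D) :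
    ∃ η : ℝ, 0 < η ∧ ∃ a : ℝ, 0 < a ∧ ∃ b : ℝ, 0 < b ∧ ball ((1, 0) : ℂ × ℂ) η ⊆ U ∧
      ∀ q ∈ ball ((1, 0) : ℂ × ℂ) η, ∀ t : ℝ, 0 ≤ t →
        q + t • ((1, 0) : ℂ × ℂ) ∈ ball ((1, 0) : ℂ × ℂ) η →
          a * t ≤ ρ (q + t • ((1, 0) : ℂ × ℂ)) - ρ q ∧
          ρ (q + t • ((1, 0) : ℂ × ℂ)) - ρ q ≤ b * t := by
  set e : ℂ × ℂ := (1, 0) with he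
  set c := fderiv ℝ ρ (1, 0) e with hc
  have hcpos : 0 < c := h.fderiv_one_zero_pos hD1 hfr
  have hcont : ContinuousAt (fun q => fderiv ℝ ρ q e) (1, 0) :=
    ((h.2.2.1.continuousOn_fderiv_of_isOpen h.1 (by simp)).clm_apply
      continuousOn_const).continuousAt (h.1.mem_nhds h.2.1)
  have h1 : ∀ᶠ q in 𝓝 ((1, 0) : ℂ × ℂ), c / 2 < fderiv ℝ ρ q e :=
    hcont.eventually (lt_mem_nhds (by linarith))
  have h2 : ∀ᶠ q in 𝓝 ((1, 0) : ℂ × ℂ), fderiv ℝ ρ q e < 2 * c :=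
    hcont.eventually (gt_mem_nhds (by linarith))
  obtain ⟨η, hη, hball⟩ := Metric.eventually_nhds_iff_ball.1
    (h1.and (h2.and (eventually_mem_set.2 (h.1.mem_nhds h.2.1))))
  refine ⟨η, hη, c / 2, by positivity, 2 * c, by positivity, fun q hq => (hball q hq).2.2, ?_⟩
  intro q hq t ht hqt
  have hseg : ∀ s ∈ Icc 0 t, q + s • e ∈ ball ((1, 0) : ℂ × ℂ) η := by
    intro s hs
    rcases eq_or_lt_of_le ht with rfl | ht
    · obtain rfl : s = 0 := le_antisymm hs.2 hs.1
      exact hqt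
    · have := (convex_ball ((1, 0) : ℂ × ℂ) η).add_smul_mem hq hqt
        (t := s / t) ⟨div_nonneg hs.1 ht.le, div_le_one_of_le₀ hs.2 ht.le⟩
      rwa [smul_smul, div_mul_cancel₀ _ ht.ne'] at this
  have hder : ∀ s ∈ Icc 0 t, HasDerivAt (fun t : ℝ => ρ (q + t • e)) (fderiv ℝ ρ (q + s • e) e) s :=
    fun s hs => h.hasDerivAt_line (hball _ (hseg s hs)).2.2
  have hct : ContinuousOn (fun t : ℝ => ρ (q + t • e)) (Icc 0 t) :=
    fun s hs => (hder s hs).continuousAt.continuousWithinAt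
  have hdi : DifferentiableOn ℝ (fun t : ℝ => ρ (q + t • e)) (interior (Icc 0 t)) :=
    fun s hs => (hder s (interior_subset hs)).differentiableAt.differentiableWithinAt
  constructor
  · have := (convex_Icc 0 t).mul_sub_le_image_sub_of_le_deriv hct hdi (C := c / 2) (fun s hs => by
      rw [(hder s (interior_subset hs)).deriv]
      exact (hball _ (hseg s (interior_subset hs))).1.le) 0 (left_mem_Icc.2 ht) t
      (right_mem_Icc.2 ht) ht
    simpa using this
  · have := (convex_Icc 0 t).image_sub_le_mul_sub_of_deriv_le hct hdi (C := 2 * c) (fun s hs => by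
      rw [(hder s (interior_subset hs)).deriv]
      exact (hball _ (hseg s (interior_subset hs))).2.1.le) 0 (left_mem_Icc.2 ht) t
      (right_mem_Icc.2 ht) ht
    simpa using this

theorem mem_ball_one_zero_real {x : ℝ} {w : ℂ} {η : ℝ} :
    (((x : ℂ), w) : ℂ × ℂ) ∈ ball ((1, 0) : ℂ × ℂ) η ↔ |x - 1| < η ∧ ‖w‖ < η := by
  rw [mem_ball, dist_eq_norm, Prod.norm_def, max_lt_iff]
  have : (x : ℂ) - 1 = ((x - 1 : ℝ) : ℂ) := by simp
  simp [this, Complex.norm_real, -Complex.ofReal_sub]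

/-- Normal growth makes `m s = ρ (1, s)` comparable with the horizontal gap between `(1, s)` and
`D`, so the Taylor dichotomy for `m` becomes one for `D`. -/
theorem IsLocalDefiningFunction.isFlat_or_hasFiniteContact
    (h : IsLocalDefiningFunction D (1, 0) U ρ) (hR : IsCompleteReinhardt D)
    (hD1 : ∀ p ∈ D, ‖p.1‖ < 1) (hfr : ((1, 0) : ℂ × ℂ) ∈ frontier D) :
    IsFlat D ∨ HasFiniteContact D := by
  obtain ⟨η, hη, a, ha, b, hb, hU, hgrow⟩ := h.exists_normal_growth hD1 hfr
  set m : ℝ → ℝ := fun s => ρ (1, (s : ℂ)) with hm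
  have hin : ∀ s ∈ Icc (-(η / 2)) (η / 2), ((1, (s : ℂ)) : ℂ × ℂ) ∈ ball ((1, 0) : ℂ × ℂ) η := by
    intro s hs
    have := mem_ball_one_zero_real (x := 1) (w := s) (η := η)
    rw [Complex.ofReal_one] at this
    rw [this, Complex.norm_real, Real.norm_eq_abs, sub_self, abs_zero]
    exact ⟨hη, by have := abs_le.2 hs; linarith⟩
  have hms : ContDiffOn ℝ ∞ m (Icc (-(η / 2)) (η / 2)) := by
    refine h.2.2.1.comp (ContDiff.contDiffOn ?_) fun s hs => hU (hin s hs)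
    exact contDiff_const.prodMk Complex.ofRealCLM.contDiff
  have hgrow' : ∀ x s : ℝ, 1 - η < x → x ≤ 1 → |s| < η →
      a * (1 - x) ≤ m s - ρ (x, (s : ℂ)) ∧ m s - ρ (x, (s : ℂ)) ≤ b * (1 - x) := by
    intro x s hx hx1 hs
    have := hgrow ((x : ℂ), (s : ℂ)) (mem_ball_one_zero_real.2 ⟨by
      rw [abs_lt]; constructor <;> linarith, by simpa using hs⟩) (1 - x) (by linarith)
    have he : (((x : ℂ), (s : ℂ)) : ℂ × ℂ) + (1 - x) • ((1, 0) : ℂ × ℂ) = (1, (s : ℂ)) := by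
      simp
    rw [he] at this
    refine this ?_
    have := mem_ball_one_zero_real (x := 1) (w := s) (η := η)
    rw [Complex.ofReal_one] at this
    rw [this]
    exact ⟨by simpa using hη, by simpa using hs⟩
  have hxU : ∀ x s : ℝ, 1 - η < x → x ≤ 1 → |s| < η → (((x : ℂ), (s : ℂ)) : ℂ × ℂ) ∈ U := by
    intro x s hx hx1 hs
    exact hU (mem_ball_one_zero_real.2 ⟨by
      rw [abs_lt]; constructor <;> linarith, by simpa using hs⟩)
  rcases ContDiffOn.isBigO_or_exists_mul_pow_le (half_pos hη) hms (fun s hs =>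
    h.nonneg_of_one_le_norm hD1 (hU (hin s hs)) (by simp)) (by
      simpa [hm] using h.apply_eq_zero hD1 hfr) with hf | ⟨k, hk, c, hc, hcm⟩
  · left
    intro N
    have h1 : Tendsto (fun s : ℝ => 1 / a * |s| ^ (N + 1)) (𝓝 0) (𝓝 0) := by
      have : Continuous fun s : ℝ => 1 / a * |s| ^ (N + 1) := by fun_prop
      simpa using this.tendsto 0
    have h2 : ∀ᶠ s : ℝ in 𝓝 0, |s| < η := by
      have : Continuous fun s : ℝ => |s| := by fun_prop
      exact (this.tendsto 0).eventually (gt_mem_nhds (by simpa using hη))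
    obtain ⟨δ, hδ, hball⟩ := Metric.eventually_nhds_iff_ball.1
      ((hf (N + 1)).and (h2.and ((h1.eventually (gt_mem_nhds (half_pos hη))).and
        (h1.eventually (gt_mem_nhds (half_pos one_pos))))))
    refine ⟨1 / a, by positivity, δ, hδ, fun s x hs hsδ hx hxs => ?_⟩
    obtain ⟨h3, h4, h5, h6⟩ := hball s (by simpa [abs_of_nonneg hs] using hsδ)
    rw [abs_of_nonneg hs] at h3 h5 h6
    -- `ρ` is controlled only near `(1, 0)`: the point is moved right into that region, and
    -- completeness of `D` brings it back to `x`.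
    set y := max (max x (1 - η / 2)) (1 / 2) with hy
    have hys : y < 1 - 1 / a * s ^ (N + 1) :=
      max_lt (max_lt hxs (by linarith)) (by linarith)
    have hpos : 0 ≤ 1 / a * s ^ (N + 1) := by positivity
    have hy1 : 1 - η < y := lt_of_lt_of_le (by linarith) ((le_max_right _ _).trans (le_max_left _ _))
    have hyD : (((y : ℂ), (s : ℂ)) : ℂ × ℂ) ∈ D := by
      refine (h.2.2.2.1 _ (hxU y s hy1 (by linarith) h4)).2 ?_
      have h7 := (hgrow' y s hy1 (by linarith) h4).1
      have h8 : s ^ (N + 1) < a * (1 - y) := by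
        have : 1 / a * s ^ (N + 1) < 1 - y := by linarith
        rw [one_div, inv_mul_lt_iff₀ ha] at this
        exact this
      linarith
    refine hR.mem_of_norm_le hyD ?_ le_rfl
    simp only [Complex.norm_real, Real.norm_eq_abs]
    rw [abs_of_nonneg hx]
    exact ((le_max_left _ _).trans (le_max_left _ _)).trans (le_abs_self y)
  · right
    have h1 : Tendsto (fun s : ℝ => c / b * s ^ k) (𝓝[>] 0) (𝓝 0) := by
      refine tendsto_nhdsWithin_of_tendsto_nhds ?_
      have : Continuous fun s : ℝ => c / b * s ^ k := by fun_prop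
      have h3 := this.tendsto 0
      rwa [zero_pow (by omega), mul_zero] at h3
    have h2 : ∀ᶠ s : ℝ in 𝓝[>] 0, s < η :=
      (eventually_mem_set.2 (Iio_mem_nhds hη)).filter_mono nhdsWithin_le_nhds
    obtain ⟨δ, hδ, hball⟩ := mem_nhdsGT_iff_exists_Ioo_subset.1
      (hcm.and (h2.and ((h1.eventually (gt_mem_nhds hη)).and (h1.eventually (gt_mem_nhds one_pos)))))
    refine ⟨k, hk, c / b, by positivity, δ, hδ, fun z w hw hD => ?_⟩
    rcases eq_or_ne w 0 with rfl | hw0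
    · rw [norm_zero, zero_pow (by omega), mul_zero, sub_zero]
      exact hD1 _ hD
    have hw0 : 0 < ‖w‖ := norm_pos_iff.2 hw0
    by_contra! hlt
    obtain ⟨h3, h4, h5, h6⟩ := hball ⟨hw0, hw⟩
    set x := 1 - c / b * ‖w‖ ^ k with hx
    have hpos : 0 < c / b * ‖w‖ ^ k := by positivity
    have hxD : (((x : ℂ), (‖w‖ : ℂ)) : ℂ × ℂ) ∈ D := by
      refine hR.mem_of_norm_le hD ?_ (by simp)
      rw [Complex.norm_real, Real.norm_of_nonneg (by linarith)]
      exact hlt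
    have h7 : |‖w‖| < η := by rwa [abs_of_pos hw0]
    have h8 := (h.2.2.2.1 _ (hxU x ‖w‖ (by linarith) (by linarith) h7)).1 hxD
    have h9 := (hgrow' x ‖w‖ (by linarith) (by linarith) h7).2
    have h10 : b * (1 - x) = c * ‖w‖ ^ k := by rw [hx]; field_simp; ring
    linarith

end

/-! ### Boundary type -/

theorem le_vanishingOrder {E : Type*} [NormedAddCommGroup E] {g : ℂ → E} {n : ℕ}
    (h : g =O[𝓝 0] fun ζ : ℂ => ‖ζ‖ ^ n) : (n : ℕ∞) ≤ vanishingOrder g :=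
  le_iSup₂_of_le n h le_rfl

theorem vanishingOrder_le {E : Type*} [NormedAddCommGroup E] {g : ℂ → E} {K : ℕ∞}
    (h : ∀ n : ℕ, (g =O[𝓝 0] fun ζ : ℂ => ‖ζ‖ ^ n) → (n : ℕ∞) ≤ K) : vanishingOrder g ≤ K :=
  iSup₂_le h

theorem tendsto_ofReal_mul_nhdsGT (u : ℂ) :
    Tendsto (fun r : ℝ => (r : ℂ) * u) (𝓝[>] 0) (𝓝 0) := by
  refine tendsto_nhdsWithin_of_tendsto_nhds ?_
  have : Continuous fun r : ℝ => (r : ℂ) * u := by fun_prop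
  simpa using this.tendsto 0

theorem isBigO_norm_pow_of_le {E : Type*} [NormedAddCommGroup E] {g : ℂ → E} {m n : ℕ}
    (hmn : m ≤ n) (h : g =O[𝓝 0] fun ζ : ℂ => ‖ζ‖ ^ n) :
    g =O[𝓝 0] fun ζ : ℂ => ‖ζ‖ ^ m := by
  refine h.trans (Asymptotics.IsBigO.of_bound 1 ?_)
  filter_upwards [ball_mem_nhds (0 : ℂ) one_pos] with z hz
  rw [one_mul, norm_pow, norm_pow, norm_norm]
  exact pow_le_pow_of_le_one (norm_nonneg _) (mem_ball_zero_iff.1 hz).le hmn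

/-- The lower order of two holomorphic germs vanishing at `0`, not both zero, is realized along a
ray on which the first one has nonnegative real part. -/
theorem exists_ray_order {g h : ℂ → ℂ} (hg : AnalyticAt ℂ g 0) (hh : AnalyticAt ℂ h 0)
    (hg0 : g 0 = 0) (hne : ¬ ((∀ᶠ z in 𝓝 0, g z = 0) ∧ ∀ᶠ z in 𝓝 0, h z = 0)) :
    ∃ m : ℕ, ∃ u : ℂ, ‖u‖ = 1 ∧ ∃ a : ℝ, 0 < a ∧
      (g =O[𝓝 0] fun ζ : ℂ => ‖ζ‖ ^ m) ∧ (h =O[𝓝 0] fun ζ : ℂ => ‖ζ‖ ^ m) ∧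
      (∀ᶠ r : ℝ in 𝓝[>] 0, 0 ≤ (g (r * u)).re) ∧
      ((∀ᶠ r : ℝ in 𝓝[>] 0, a * r ^ m ≤ (g (r * u)).re) ∨
        ∀ᶠ r : ℝ in 𝓝[>] 0, a * r ^ m ≤ ‖h (r * u)‖) := by
  have hO : ∀ {f : ℂ → ℂ} {n : ℕ} {α : ℂ},
      (∀ᶠ z in 𝓝 0, ‖f z - z ^ n • α‖ ≤ ‖α‖ / 2 * ‖z‖ ^ n) →
      f =O[𝓝 0] fun ζ : ℂ => ‖ζ‖ ^ n := by
    intro f n α hf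
    refine Asymptotics.IsBigO.of_bound (2 * ‖α‖) ?_
    filter_upwards [hf] with z hz
    have h1 := norm_le_norm_add_norm_sub' (f z) (z ^ n • α)
    rw [norm_smul, norm_pow] at h1
    rw [norm_pow, norm_norm]
    have : 0 ≤ ‖α‖ * ‖z‖ ^ n := by positivity
    linarith
  have hO0 : ∀ {f : ℂ → ℂ} (n : ℕ), (∀ᶠ z in 𝓝 0, f z = 0) → f =O[𝓝 0] fun ζ : ℂ => ‖ζ‖ ^ n := by
    intro f n hf
    refine Asymptotics.IsBigO.of_bound 0 ?_
    filter_upwards [hf] with z hz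
    simp [hz]
  have hlow : ∀ {f : ℂ → ℂ} {n : ℕ} {α : ℂ} (u : ℂ), ‖u‖ = 1 →
      (∀ᶠ z in 𝓝 0, ‖f z - z ^ n • α‖ ≤ ‖α‖ / 2 * ‖z‖ ^ n) →
      ∀ᶠ r : ℝ in 𝓝[>] 0, ‖α‖ / 2 * r ^ n ≤ ‖f (r * u)‖ := by
    intro f n α u hu hf
    filter_upwards [(tendsto_ofReal_mul_nhdsGT u).eventually hf, self_mem_nhdsWithin] with r hr hr0
    have hr0 : 0 < r := hr0
    have h1 := norm_le_norm_add_norm_sub' (((r : ℂ) * u) ^ n • α) (f (r * u))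
    rw [norm_sub_rev] at h1
    have h2 : ‖(r : ℂ) * u‖ = r := by simp [hu, abs_of_pos hr0]
    rw [norm_smul, norm_pow, h2] at h1
    rw [h2] at hr
    linarith
  by_cases hgz : ∀ᶠ z in 𝓝 0, g z = 0
  · obtain ⟨l, β, hβ, hl⟩ := hh.exists_pow_mul_le_norm fun hhz => hne ⟨hgz, hhz⟩
    refine ⟨l, 1, norm_one, ‖β‖ / 2, by positivity, hO0 l hgz, hO hl, ?_,
      Or.inr (hlow 1 norm_one hl)⟩
    filter_upwards [(tendsto_ofReal_mul_nhdsGT 1).eventually hgz] with r hr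
    rw [hr, Complex.zero_re]
  obtain ⟨n, α, hα, hn⟩ := hg.exists_pow_mul_le_norm hgz
  have hn1 : n ≠ 0 := by
    rintro rfl
    have := hn.self_of_nhds
    simp only [hg0, pow_zero, one_smul, zero_sub, norm_neg, mul_one] at this
    linarith [norm_pos_iff.2 hα]
  -- On the ray through this `u` the leading term `α z ^ n` of `g` is real and positive.
  obtain ⟨u, hu⟩ := IsAlgClosed.exists_pow_nat_eq ((‖α‖ : ℂ) / α) (Nat.pos_of_ne_zero hn1)
  have hu1 : ‖u‖ = 1 := by
    have : ‖u‖ ^ n = 1 := by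
      rw [← norm_pow, hu, norm_div, Complex.norm_real, norm_norm, div_self (norm_ne_zero_iff.2 hα)]
    exact (pow_eq_one_iff_of_nonneg (norm_nonneg _) hn1).1 this
  have hre : ∀ᶠ r : ℝ in 𝓝[>] 0, ‖α‖ / 2 * r ^ n ≤ (g (r * u)).re := by
    filter_upwards [(tendsto_ofReal_mul_nhdsGT u).eventually hn, self_mem_nhdsWithin] with r hr hr0
    have hr0 : 0 < r := hr0
    have h1 : ((r : ℂ) * u) ^ n • α = ((‖α‖ * r ^ n : ℝ) : ℂ) := by
      rw [mul_pow, hu, smul_eq_mul]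
      push_cast
      field_simp
    have h2 : ‖(r : ℂ) * u‖ = r := by simp [hu1, abs_of_pos hr0]
    rw [h1, h2] at hr
    have h3 := (abs_le.1 ((Complex.abs_re_le_norm _).trans hr)).1
    rw [Complex.sub_re, Complex.ofReal_re] at h3
    linarith
  have hre0 : ∀ᶠ r : ℝ in 𝓝[>] 0, 0 ≤ (g (r * u)).re := by
    filter_upwards [hre, self_mem_nhdsWithin] with r hr hr0
    have hr0 : 0 < r := hr0
    exact le_trans (by positivity) hr
  by_cases hhz : ∀ᶠ z in 𝓝 0, h z = 0
  · exact ⟨n, u, hu1, ‖α‖ / 2, by positivity, hO hn, hO0 n hhz, hre0, Or.inl hre⟩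
  obtain ⟨l, β, hβ, hl⟩ := hh.exists_pow_mul_le_norm hhz
  rcases le_total n l with hnl | hln
  · exact ⟨n, u, hu1, ‖α‖ / 2, by positivity, hO hn, isBigO_norm_pow_of_le hnl (hO hl), hre0,
      Or.inl hre⟩
  · exact ⟨l, u, hu1, ‖β‖ / 2, by positivity, isBigO_norm_pow_of_le hln (hO hn), hO hl, hre0,
      Or.inr (hlow u hu1 hl)⟩

section

variable {D U : Set (ℂ × ℂ)} {ρ : ℂ × ℂ → ℝ}

/-- The curve `ζ ↦ (1, ζ)` has infinite contact: flatness puts `(1 - t, ζ)` in `D` for `t = 2C|ζ| ^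
(N + 1)` and `ζ ≠ 0` small, and then `ρ (1, ζ) ≤ b t`. -/
theorem IsLocalDefiningFunction.boundaryType_eq_top (h : IsLocalDefiningFunction D (1, 0) U ρ)
    (hR : IsCompleteReinhardt D)
    (hD1 : ∀ p ∈ D, ‖p.1‖ < 1) (hfr : ((1, 0) : ℂ × ℂ) ∈ frontier D) (hflat : IsFlat D) :
    boundaryType ρ (1, 0) = ⊤ := by
  obtain ⟨η, hη, a, ha, b, hb, hU, hgrow⟩ := h.exists_normal_growth hD1 hfr
  rw [eq_top_iff, boundaryType]
  have hγ : (fun ζ : ℂ => ((1, ζ) : ℂ × ℂ)) ∈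
      {γ : ℂ → ℂ × ℂ | IsHolomorphicCurveThrough γ (1, 0)} := by
    refine ⟨analyticAt_const.prod analyticAt_id, rfl, fun hev => ?_⟩
    have : ∀ᶠ ζ in 𝓝[≠] (0 : ℂ), False := by
      filter_upwards [hev.filter_mono nhdsWithin_le_nhds, self_mem_nhdsWithin] with ζ h1 h2
      exact h2 (Prod.mk.inj h1).2
    exact (this.exists).elim fun _ => id
  refine le_iSup₂_of_le _ hγ ?_
  have hden : vanishingOrder (fun ζ : ℂ => ((1, ζ) : ℂ × ℂ) - (1, 0)) ≤ (1 : ℕ) := by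
    refine vanishingOrder_le fun n hn => ?_
    obtain ⟨C, hC⟩ := hn.bound
    refine Nat.cast_le.2 (le_of_eventually_mul_pow_le_mul_pow (c := 1) (C := C) one_pos ?_)
    filter_upwards [(tendsto_ofReal_mul_nhdsGT 1).eventually hC, self_mem_nhdsWithin] with r hr hr0
    have hr0 : 0 < r := hr0
    have h1 : r ≤ C * r ^ n ∧ 0 ≤ C * r ^ n := by
      simpa [abs_of_pos hr0, Prod.norm_def, and_comm] using hr
    simpa using h1.1
  have hnum : vanishingOrder (fun ζ : ℂ => ρ (1, ζ)) = ⊤ := by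
    refine ENat.eq_top_iff_forall_ge.2 fun N => le_vanishingOrder ?_
    obtain ⟨C, hC, δ, hδ, hCδ⟩ := hflat N
    refine Asymptotics.IsBigO.of_bound (b * (2 * C)) ?_
    have h1 : Tendsto (fun ζ : ℂ => 2 * C * ‖ζ‖ ^ (N + 1)) (𝓝 0) (𝓝 0) := by
      have : Continuous fun ζ : ℂ => 2 * C * ‖ζ‖ ^ (N + 1) := by fun_prop
      simpa using this.tendsto 0
    have h2 : Tendsto (fun ζ : ℂ => ‖ζ‖) (𝓝 0) (𝓝 0) := by
      simpa using (continuous_norm (E := ℂ)).tendsto 0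
    filter_upwards [h1.eventually (gt_mem_nhds hη), h1.eventually (gt_mem_nhds one_pos),
      h2.eventually (gt_mem_nhds hη), h2.eventually (gt_mem_nhds hδ),
      h2.eventually (gt_mem_nhds one_pos)] with ζ h3 h4 h5 h6 h7
    set t := 2 * C * ‖ζ‖ ^ (N + 1) with ht
    have ht0 : 0 ≤ t := by positivity
    have hb1 : ((1, ζ) : ℂ × ℂ) ∈ ball ((1, 0) : ℂ × ℂ) η := by
      have := mem_ball_one_zero_real (x := 1) (w := ζ) (η := η)
      rw [Complex.ofReal_one] at this
      rw [this]
      exact ⟨by simpa using hη, h5⟩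
    have hb2 : ((((1 - t : ℝ) : ℂ), ζ) : ℂ × ℂ) ∈ ball ((1, 0) : ℂ × ℂ) η :=
      mem_ball_one_zero_real.2 ⟨by rw [abs_lt]; constructor <;> linarith, h5⟩
    have he : ((((1 - t : ℝ) : ℂ), ζ) : ℂ × ℂ) + t • ((1, 0) : ℂ × ℂ) = (1, ζ) := by
      simp
    have h8 := hgrow _ hb2 t ht0 (by rwa [he])
    rw [he] at h8
    have hnn := h.nonneg_of_one_le_norm hD1 (hU hb1) (by simp)
    rw [Real.norm_of_nonneg hnn, norm_pow, norm_norm]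
    have hneg : ρ (((1 - t : ℝ) : ℂ), ζ) ≤ 0 := by
      rcases eq_or_ne ζ 0 with rfl | hζ
      · have : t = 0 := by rw [ht]; simp
        rw [this]
        simpa using (h.apply_eq_zero hD1 hfr).le
      · have : 0 < C * ‖ζ‖ ^ (N + 1) := by
          have := norm_pos_iff.2 hζ
          positivity
        have hm := hCδ ‖ζ‖ (1 - t) (norm_nonneg _) h6 (by linarith) (by linarith)
        exact ((h.2.2.2.1 _ (hU hb2)).1
          ((hR.mem_congr (p := (((1 - t : ℝ) : ℂ), ζ)) (q := (((1 - t : ℝ) : ℂ), (‖ζ‖ : ℂ)))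
            rfl (by simp)).2 hm)).le
    have h9 : t ≤ 2 * C * ‖ζ‖ ^ N := by
      rw [ht, pow_succ]
      have : ‖ζ‖ ^ N * ‖ζ‖ ≤ ‖ζ‖ ^ N := mul_le_of_le_one_right (by positivity) h7.le
      gcongr
    nlinarith
  rw [hnum]
  -- In `ℝ≥0∞` the quotient `⊤ / ⊤` is `0`, so the denominator must be finite.
  have : ((vanishingOrder (fun ζ : ℂ => ((1, ζ) : ℂ × ℂ) - (1, 0)) : ℕ∞) : ℝ≥0∞) ≠ ⊤ := by
    rw [Ne, ENat.toENNReal_eq_top]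
    exact ne_top_of_le_ne_top (ENat.natCast_ne_top 1) hden
  rw [ENat.toENNReal_top, ENNReal.top_div, if_neg this]

/-- The type is at most `k`. For a curve of order `m` there is a ray with `Re z ≥ 1` on which `Re z
- 1` or `|w|` is at least a multiple of `r ^ m`; by `hlow`, `ρ` is then at least a multiple of `r ^
m` or of `r ^ (k m)`. -/
theorem IsLocalDefiningFunction.boundaryType_ne_top (h : IsLocalDefiningFunction D (1, 0) U ρ)
    (hD1 : ∀ p ∈ D, ‖p.1‖ < 1) (hfr : ((1, 0) : ℂ × ℂ) ∈ frontier D)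
    (hfin : HasFiniteContact D) : boundaryType ρ (1, 0) ≠ ⊤ := by
  obtain ⟨η, hη, a, ha, b, hb, hU, hgrow⟩ := h.exists_normal_growth hD1 hfr
  obtain ⟨k, hk, c, hc, δ, hδ, hcon⟩ := hfin
  -- Moving `p` left until `Re z = 1 - c|w| ^ k` still leaves it outside `D`, where `ρ ≥ 0`; normal
  -- growth accounts for the distance moved.
  have hlow : ∀ᶠ p : ℂ × ℂ in 𝓝 (1, 0), 1 ≤ p.1.re →
      a * (p.1.re - 1 + c * ‖p.2‖ ^ k) ≤ ρ p := by
    have h1 : ContinuousAt (fun p : ℂ × ℂ =>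
        p - (p.1.re - 1 + c * ‖p.2‖ ^ k) • ((1, 0) : ℂ × ℂ)) (1, 0) := by fun_prop
    have h2 : ((1, 0) : ℂ × ℂ) - (((1, 0) : ℂ × ℂ).1.re - 1 + c * ‖((1, 0) : ℂ × ℂ).2‖ ^ k) •
        ((1, 0) : ℂ × ℂ) = (1, 0) := by
      have : k ≠ 0 := by omega
      simp [this]
    have h3 := h1.eventually_mem (s := ball ((1, 0) : ℂ × ℂ) η) (by
      rw [h2]; exact ball_mem_nhds _ hη)
    have h4 : ∀ᶠ p : ℂ × ℂ in 𝓝 (1, 0), ‖p.2‖ < δ := by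
      have : Continuous fun p : ℂ × ℂ => ‖p.2‖ := by fun_prop
      exact this.continuousAt.eventually (gt_mem_nhds (by simpa using hδ))
    filter_upwards [h3, h4, ball_mem_nhds _ hη] with p hp hpδ hpη hre
    set t := p.1.re - 1 + c * ‖p.2‖ ^ k with ht
    have ht0 : 0 ≤ t := by
      have : 0 ≤ c * ‖p.2‖ ^ k := by positivity
      linarith
    set q := p - t • ((1, 0) : ℂ × ℂ) with hq
    have hqp : q + t • ((1, 0) : ℂ × ℂ) = p := by rw [hq]; abel
    have h5 := (hgrow q hp t ht0 (by rwa [hqp])).1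
    rw [hqp] at h5
    have h6 : 0 ≤ ρ q := by
      by_contra! hneg
      have hqD := (h.2.2.2.1 q (hU hp)).2 hneg
      have hq2 : q.2 = p.2 := by simp [hq]
      have h7 := hcon q.1 q.2 (by rwa [hq2]) hqD
      have h8 : q.1.re = 1 - c * ‖p.2‖ ^ k := by
        have : q.1.re = p.1.re - t := by simp [hq, -Complex.ofReal_add]
        rw [this, ht]
        ring
      rw [hq2, ← h8] at h7
      exact absurd (Complex.re_le_norm q.1) (not_le.2 h7)
    linarith
  refine ne_top_of_le_ne_top (ENNReal.natCast_ne_top k) (iSup₂_le fun γ hγ => ?_)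
  obtain ⟨hγa, hγ0, hγne⟩ := hγ
  refine ENNReal.div_le_of_le_mul ?_
  set g : ℂ → ℂ := fun ζ => (γ ζ).1 - 1 with hg
  set w : ℂ → ℂ := fun ζ => (γ ζ).2 with hw
  have hga : AnalyticAt ℂ g 0 := (analyticAt_fst.comp hγa).sub analyticAt_const
  have hwa : AnalyticAt ℂ w 0 := analyticAt_snd.comp hγa
  obtain ⟨m, u, hu, α, hα, hgO, hwO, hre, hor⟩ := exists_ray_order hga hwa (by simp [hg, hγ0])
    (fun hh => hγne (by
      filter_upwards [hh.1, hh.2] with ζ h1 h2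
      exact Prod.ext (sub_eq_zero.1 h1) h2))
  have hm : (m : ℕ∞) ≤ vanishingOrder fun ζ => γ ζ - (1, 0) := by
    refine le_vanishingOrder ?_
    have : (fun ζ => γ ζ - (1, 0)) = fun ζ => (g ζ, w ζ) := by
      funext ζ
      ext <;> simp [hg, hw]
    rw [this]
    exact hgO.prod_left hwO
  have hkm : vanishingOrder (fun ζ => ρ (γ ζ)) ≤ ((k * m : ℕ) : ℕ∞) := by
    refine vanishingOrder_le fun M hM => Nat.cast_le.2 ?_
    obtain ⟨C, hC⟩ := hM.bound
    have hray := tendsto_ofReal_mul_nhdsGT u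
    have hγt : Tendsto (fun r : ℝ => γ (r * u)) (𝓝[>] 0) (𝓝 (1, 0)) := by
      have := hγa.continuousAt.tendsto
      rw [hγ0] at this
      exact this.comp hray
    have key : ∀ᶠ r : ℝ in 𝓝[>] 0,
        a * ((g (r * u)).re + c * ‖w (r * u)‖ ^ k) ≤ C * r ^ M := by
      filter_upwards [hγt.eventually hlow, hray.eventually hC, hre, self_mem_nhdsWithin]
        with r h1 h2 h3 hr0
      have hr0 : 0 < r := hr0
      have h4 : ‖(r : ℂ) * u‖ = r := by simp [hu, abs_of_pos hr0]
      have h5 : (g (r * u)).re = (γ (r * u)).1.re - 1 := by simp [hg]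
      rw [h5] at h3 ⊢
      rw [h4, norm_pow, Real.norm_of_nonneg hr0.le] at h2
      exact (h1 (by linarith)).trans ((Real.le_norm_self _).trans h2)
    rcases hor with h1 | h1
    · have : M ≤ m := by
        refine le_of_eventually_mul_pow_le_mul_pow (c := a * α) (C := C) (by positivity) ?_
        filter_upwards [key, h1] with r h2 h3
        have : 0 ≤ c * ‖w (r * u)‖ ^ k := by positivity
        nlinarith
      exact this.trans (Nat.le_mul_of_pos_left m (by omega))
    · refine le_of_eventually_mul_pow_le_mul_pow (c := a * (c * α ^ k)) (C := C) (by positivity) ?_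
      filter_upwards [key, h1, hre, self_mem_nhdsWithin] with r h2 h3 h4 hr0
      have hr0 : 0 < r := hr0
      have h5 : (α * r ^ m) ^ k ≤ ‖w (r * u)‖ ^ k := pow_le_pow_left₀ (by positivity) h3 k
      refine le_trans ?_ h2
      have h6 : a * (c * α ^ k) * r ^ (k * m) = a * (c * (α * r ^ m) ^ k) := by
        rw [mul_pow, ← pow_mul, mul_comm m k]; ring
      rw [h6]
      have := mul_le_mul_of_nonneg_left h5 hc.le
      exact mul_le_mul_of_nonneg_left (by linarith) ha.le
  calc ((vanishingOrder fun ζ => ρ (γ ζ) : ℕ∞) : ℝ≥0∞) ≤ (((k * m : ℕ) : ℕ∞) : ℝ≥0∞) :=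
        ENat.toENNReal_le.2 hkm
    _ = (k : ℝ≥0∞) * (((m : ℕ) : ℕ∞) : ℝ≥0∞) := by simp
    _ ≤ _ := mul_le_mul_right (ENat.toENNReal_le.2 hm) _

theorem isOfInfiniteTypeAt_iff_isFlat (hs : HasSmoothBoundaryNear D (1, 0))
    (hR : IsCompleteReinhardt D)
    (hD1 : ∀ p ∈ D, ‖p.1‖ < 1) (hfr : ((1, 0) : ℂ × ℂ) ∈ frontier D) :
    IsOfInfiniteTypeAt D (1, 0) ↔ IsFlat D := by
  constructor
  · rintro ⟨U, ρ, h, htop⟩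
    refine (h.isFlat_or_hasFiniteContact hR hD1 hfr).resolve_right fun hfin => ?_
    exact h.boundaryType_ne_top hD1 hfr hfin htop
  · intro hflat
    obtain ⟨U, ρ, h⟩ := hs
    exact ⟨U, ρ, h, h.boundaryType_eq_top hR hD1 hfr hflat⟩

end

/-! ### Pseudoconvexity gives logarithmic convexity -/

theorem circleAverage_le_of_le_add_re {v : ℂ → ℝ} {g : ℂ → ℂ} {b : ℝ}
    (hv : ContinuousOn v (sphere 0 1)) (hg : DifferentiableOn ℂ g (closedBall 0 1)) (hg0 : g 0 = 0)
    (h : ∀ ζ ∈ sphere (0 : ℂ) 1, v ζ ≤ b + (g ζ).re) : Real.circleAverage v 0 1 ≤ b := by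
  have hgc : ContinuousOn g (sphere 0 1) := hg.continuousOn.mono sphere_subset_closedBall
  have hgi : CircleIntegrable g 0 1 := hgc.circleIntegrable zero_le_one
  have hre : Real.circleAverage (fun ζ => (g ζ).re) 0 1 = 0 := by
    have h1 := ContinuousLinearMap.circleAverage_comp_comm Complex.reCLM hgi
    have h2 : Real.circleAverage g 0 1 = g 0 := by
      apply DiffContOnCl.circleAverage
      rw [abs_one]
      apply DifferentiableOn.diffContOnCl
      rwa [closure_ball _ one_ne_zero]
    rw [h2, hg0] at h1
    simpa [Function.comp_def] using h1
  have hrec : ContinuousOn (fun ζ => (g ζ).re) (sphere 0 1) :=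
    Complex.continuous_re.comp_continuousOn hgc
  calc Real.circleAverage v 0 1 ≤ Real.circleAverage (fun ζ => b + (g ζ).re) 0 1 := by
        refine Real.circleAverage_mono (hv.circleIntegrable zero_le_one)
          ((continuousOn_const.add hrec).circleIntegrable zero_le_one) fun ζ hζ => h ζ ?_
        simpa using hζ
    _ = b := by
        rw [Real.circleAverage_fun_add (continuousOn_const.circleIntegrable zero_le_one)
          (hrec.circleIntegrable zero_le_one), hre, Real.circleAverage_const, add_zero]

/-- The point of the positive quadrant with logarithmic coordinates `(x, y)`. -/
noncomputable def expPair (x y : ℝ) : ℂ × ℂ := ((Real.exp x : ℂ), (Real.exp y : ℂ))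

theorem continuous_expPair {X : Type*} [TopologicalSpace X] {f g : X → ℝ} (hf : Continuous f)
    (hg : Continuous g) : Continuous fun p => expPair (f p) (g p) := by
  unfold expPair
  fun_prop

theorem norm_expPair_fst (x y : ℝ) : ‖(expPair x y).1‖ = Real.exp x := by
  simp only [expPair, Complex.norm_real, Real.norm_eq_abs, Real.abs_exp]

theorem norm_expPair_snd (x y : ℝ) : ‖(expPair x y).2‖ = Real.exp y := by
  simp only [expPair, Complex.norm_real, Real.norm_eq_abs, Real.abs_exp]

theorem norm_log_one_add_sub_le {z : ℂ} (hz : ‖z‖ ≤ 1 / 2) :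
    ‖Complex.log (1 + z) - z‖ ≤ ‖z‖ ^ 2 := by
  refine (Complex.norm_log_one_add_sub_self_le (by linarith)).trans ?_
  have h1 : (1 - ‖z‖)⁻¹ ≤ 2 := by
    rw [inv_le_comm₀ (by linarith) (by norm_num)]; linarith
  nlinarith [sq_nonneg ‖z‖]

theorem one_add_mem_slitPlane {z : ℂ} (hz : ‖z‖ ≤ 1 / 2) : 1 + z ∈ Complex.slitPlane := by
  left
  have := (abs_le.1 (Complex.abs_re_le_norm z)).1
  simp only [Complex.add_re, Complex.one_re]
  linarith

section

variable {D : Set (ℂ × ℂ)} {u : ℂ × ℂ → ℝ}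

set_option maxHeartbeats 1000000 in
/-- Maximum principle, for a plurisubharmonic function, along a segment in logarithmic
coordinates. -/
theorem IsContinuousPSHOn.le_of_le_endpoints (hu : IsContinuousPSHOn u D)
    (hR : IsCompleteReinhardt D) {x y a T σ c : ℝ} (hσ : 0 < σ)
    (hseg : ∀ t ∈ Icc 0 T, expPair (x + a * t + σ) (y + t) ∈ D)
    (h0 : ∀ p : ℂ × ℂ, ‖p.1‖ ≤ Real.exp (x + σ) → ‖p.2‖ ≤ Real.exp y → u p ≤ c)
    (h1 : ∀ p : ℂ × ℂ, ‖p.1‖ ≤ Real.exp (x + a * T + σ) → ‖p.2‖ ≤ Real.exp (y + T) → u p ≤ c)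
    {t : ℝ} (ht : t ∈ Icc 0 T) : u (expPair (x + a * t) (y + t)) ≤ c := by
  by_contra! hlt
  -- Coordinates: position along the segment, transverse logarithmic offset, and two phases. The
  -- phases are needed because the test disc leaves the positive quadrant.
  set P : Set (ℝ × ℝ × ℂ × ℂ) := Icc 0 T ×ˢ Icc (-σ) σ ×ˢ sphere 0 1 ×ˢ sphere 0 1 with hP
  have hPc : IsCompact P :=
    isCompact_Icc.prod (isCompact_Icc.prod ((isCompact_sphere 0 1).prod (isCompact_sphere 0 1)))
  set Ψ : ℝ × ℝ × ℂ × ℂ → ℂ × ℂ := fun q =>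
    ((Real.exp (x + a * q.1 + q.2.1) : ℂ) * q.2.2.1, (Real.exp (y + q.1) : ℂ) * q.2.2.2) with hΨ
  have hΨc : Continuous Ψ := by rw [hΨ]; fun_prop
  have hn1 : ∀ q ∈ P, ‖(Ψ q).1‖ = Real.exp (x + a * q.1 + q.2.1) := by
    intro q hq
    have : ‖q.2.2.1‖ = 1 := mem_sphere_zero_iff_norm.1 hq.2.2.1
    simp only [hΨ, norm_mul, this, Complex.norm_real, Real.norm_eq_abs, Real.abs_exp, mul_one]
  have hn2 : ∀ q ∈ P, ‖(Ψ q).2‖ = Real.exp (y + q.1) := by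
    intro q hq
    have : ‖q.2.2.2‖ = 1 := mem_sphere_zero_iff_norm.1 hq.2.2.2
    simp only [hΨ, norm_mul, this, Complex.norm_real, Real.norm_eq_abs, Real.abs_exp, mul_one]
  have hΨD : MapsTo Ψ P D := by
    intro q hq
    refine hR.mem_of_norm_le (hseg q.1 hq.1) ?_ ?_
    · rw [hn1 q hq, norm_expPair_fst]
      exact Real.exp_le_exp.2 (by linarith [hq.2.1.2])
    · rw [hn2 q hq, norm_expPair_snd]
  have huc : ContinuousOn (fun q => u (Ψ q)) P := hu.1.comp hΨc.continuousOn hΨD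
  have hbase : (t, (0 : ℝ), (1 : ℂ), (1 : ℂ)) ∈ P :=
    ⟨ht, ⟨by linarith, hσ.le⟩, by simp, by simp⟩
  have hΨb : Ψ (t, 0, 1, 1) = expPair (x + a * t) (y + t) := by
    simp [hΨ, expPair]
  obtain ⟨M, hM⟩ := hPc.bddAbove_image huc
  replace hM : ∀ q ∈ P, u (Ψ q) ≤ M := fun q hq => hM (mem_image_of_mem _ hq)
  set u₁ := u (expPair (x + a * t) (y + t)) with hu₁
  set κ := u₁ - c with hκ
  have hκ0 : 0 < κ := by rw [hκ]; linarith
  -- Keeps `δ|w|² ≤ κ/2` on `P`, so the two ends cannot carry the maximum of `Φ`.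
  set δ := κ / Real.exp (2 * (y + T)) / 2 with hδ
  have hδ0 : 0 < δ := by positivity
  have hδκ : ∀ r ≤ T, δ * Real.exp (y + r) ^ 2 ≤ κ / 2 := by
    intro r hr
    have h2 : Real.exp (y + r) ^ 2 ≤ Real.exp (2 * (y + T)) := by
      rw [← Real.exp_nat_mul]
      exact Real.exp_le_exp.2 (by push_cast; linarith)
    calc δ * Real.exp (y + r) ^ 2 ≤ δ * Real.exp (2 * (y + T)) := by gcongr
      _ = κ / 2 := by rw [hδ]; field_simp
  -- Makes the penalty at offset `±σ` large enough to exclude a maximum there.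
  set l := (|M - c| + κ) / σ ^ 2 with hl
  have hl0 : 0 < l := by positivity
  have hlσ : l * σ ^ 2 = |M - c| + κ := by rw [hl]; field_simp
  -- The term `δ|w|²` makes `Φ` strictly subharmonic along the curve `z = const · w ^ a`; the
  -- penalty `l s²` localizes the maximum transversally.
  set Φ : ℝ × ℝ × ℂ × ℂ → ℝ :=
    fun q => u (Ψ q) + δ * Real.exp (y + q.1) ^ 2 - l * q.2.1 ^ 2 with hΦ
  have hΦc : ContinuousOn Φ P := by
    refine (huc.add (Continuous.continuousOn ?_)).sub (Continuous.continuousOn ?_) <;> fun_prop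
  obtain ⟨q, hq, hmax⟩ := hPc.exists_isMaxOn ⟨_, hbase⟩ hΦc
  have hΦq : u₁ < Φ q := by
    refine lt_of_lt_of_le ?_ (hmax hbase)
    simp only [hΦ, hΨb, ← hu₁]
    have : 0 < δ * Real.exp (y + t) ^ 2 := by positivity
    nlinarith
  have hlq : 0 ≤ l * q.2.1 ^ 2 := by positivity
  have hδq := hδκ q.1 hq.1.2
  have hqM := hM q hq
  have hq0 : 0 < q.1 := by
    refine lt_of_le_of_ne hq.1.1 fun h => ?_
    have h2 := h0 (Ψ q) (by
      rw [hn1 q hq, ← h]; exact Real.exp_le_exp.2 (by linarith [hq.2.1.2]))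
      (by rw [hn2 q hq, ← h, add_zero])
    simp only [hΦ] at hΦq
    linarith
  have hqT : q.1 < T := by
    refine lt_of_le_of_ne hq.1.2 fun h => ?_
    have h2 := h1 (Ψ q) (by
      rw [hn1 q hq, h]; exact Real.exp_le_exp.2 (by linarith [hq.2.1.2]))
      (by rw [hn2 q hq, h])
    simp only [hΦ] at hΦq
    linarith
  have hqσ : |q.2.1| < σ := by
    refine lt_of_le_of_ne (abs_le.2 hq.2.1) fun h => ?_
    have h2 : l * q.2.1 ^ 2 = |M - c| + κ := by rw [← hlσ, ← h, sq_abs]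
    simp only [hΦ] at hΦq
    have := le_abs_self (M - c)
    linarith
  set w := Ψ q with hw
  have hw1 : w.1 ≠ 0 := norm_ne_zero_iff.1 (by rw [hn1 q hq]; positivity)
  have hw2 : w.2 ≠ 0 := norm_ne_zero_iff.1 (by rw [hn2 q hq]; positivity)
  set K := a ^ 2 + |a| + 1 with hK
  have hK0 : 0 < K := by positivity
  -- the size of the disc
  have hsmall : ∀ᶠ ε : ℝ in 𝓝[>] 0, ε ≤ 1 / 2 ∧ |a| * ε ≤ 1 / 2 ∧ 2 * ε < q.1 ∧
      2 * ε < T - q.1 ∧ K * ε ^ 2 < σ - |q.2.1| ∧ l * K ^ 2 * ε ^ 2 < δ * ‖w.2‖ ^ 2 := by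
    have aux : ∀ (f : ℝ → ℝ), Continuous f → ∀ b, f 0 < b → ∀ᶠ ε in 𝓝[>] (0 : ℝ), f ε < b :=
      fun f hf b hb => (hf.continuousAt.eventually (gt_mem_nhds hb)).filter_mono nhdsWithin_le_nhds
    filter_upwards [aux (fun ε => ε) (by fun_prop) (1 / 2) (by norm_num),
      aux (fun ε => |a| * ε) (by fun_prop) (1 / 2) (by norm_num),
      aux (fun ε => 2 * ε) (by fun_prop) q.1 (by simpa using hq0),
      aux (fun ε => 2 * ε) (by fun_prop) (T - q.1) (by simpa using hqT),
      aux (fun ε => K * ε ^ 2) (by fun_prop) (σ - |q.2.1|) (by simpa using hqσ),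
      aux (fun ε => l * K ^ 2 * ε ^ 2) (by fun_prop) (δ * ‖w.2‖ ^ 2) (by
        have := norm_pos_iff.2 hw2
        simp only [ne_eq, OfNat.ofNat_ne_zero, not_false_eq_true, zero_pow, mul_zero]
        positivity)] with ε e1 e2 e3 e4 e5 e6
    exact ⟨e1.le, e2.le, e3, e4, e5, e6⟩
  obtain ⟨ε, ⟨e1, e2, e3, e4, e5, e6⟩, hε0⟩ := (hsmall.and self_mem_nhdsWithin).exists
  have hε0 : 0 < ε := hε0
  have hb1 : ∀ ζ : ℂ, ‖ζ‖ ≤ 1 → ‖(ε : ℂ) * ζ‖ ≤ ε := by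
    intro ζ hζ
    rw [norm_mul, Complex.norm_real, Real.norm_of_nonneg hε0.le]
    exact mul_le_of_le_one_right hε0.le hζ
  have hb2 : ∀ ζ : ℂ, ‖ζ‖ ≤ 1 → ‖(a : ℂ) * (ε * ζ)‖ ≤ |a| * ε := by
    intro ζ hζ
    rw [norm_mul, Complex.norm_real, Real.norm_eq_abs]
    exact mul_le_mul_of_nonneg_left (hb1 ζ hζ) (abs_nonneg a)
  -- `Re H` is the transverse offset gained along the affine disc `w + ζ (aε w₁, ε w₂)`. This disc
  -- is tangent to the curve, so `H` is only `O(ε²)`.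
  set H : ℂ → ℂ := fun ζ => Complex.log (1 + a * (ε * ζ)) - a * Complex.log (1 + ε * ζ) with hH
  have hHb : ∀ ζ : ℂ, ‖ζ‖ ≤ 1 → ‖H ζ‖ ≤ K * ε ^ 2 := by
    intro ζ hζ
    have h2 := norm_log_one_add_sub_le ((hb1 ζ hζ).trans e1)
    have h3 := norm_log_one_add_sub_le ((hb2 ζ hζ).trans e2)
    have h4 : H ζ = (Complex.log (1 + a * (ε * ζ)) - a * (ε * ζ)) -
        a * (Complex.log (1 + ε * ζ) - ε * ζ) := by rw [hH]; ring
    rw [h4]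
    refine (norm_sub_le _ _).trans ?_
    rw [norm_mul, Complex.norm_real, Real.norm_eq_abs]
    have h5 : ‖(a : ℂ) * (ε * ζ)‖ ^ 2 ≤ (|a| * ε) ^ 2 := pow_le_pow_left₀ (norm_nonneg _) (hb2 ζ hζ) 2
    have h6 : ‖(ε : ℂ) * ζ‖ ^ 2 ≤ ε ^ 2 := pow_le_pow_left₀ (norm_nonneg _) (hb1 ζ hζ) 2
    have h7 := mul_le_mul_of_nonneg_left (h2.trans h6) (abs_nonneg a)
    rw [mul_pow, sq_abs] at h5
    rw [hK]
    nlinarith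
  -- the disc lies in the region where `Φ` is maximized
  have hdisc : ∀ ζ : ℂ, ‖ζ‖ ≤ 1 → ∃ q' ∈ P, Ψ q' = w + ζ • ((a * ε * w.1, ε * w.2) : ℂ × ℂ) ∧
      Real.exp (y + q'.1) = ‖w.2‖ * ‖1 + (ε : ℂ) * ζ‖ ∧ q'.2.1 = q.2.1 + (H ζ).re := by
    intro ζ hζ
    have hs1 := one_add_mem_slitPlane ((hb1 ζ hζ).trans e1)
    have hs2 := one_add_mem_slitPlane ((hb2 ζ hζ).trans e2)
    set A := 1 + (ε : ℂ) * ζ with hA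
    set B := 1 + (a : ℂ) * (ε * ζ) with hB
    have hA0 : A ≠ 0 := Complex.slitPlane_ne_zero hs1
    have hB0 : B ≠ 0 := Complex.slitPlane_ne_zero hs2
    have hHre : (H ζ).re = Real.log ‖B‖ - a * Real.log ‖A‖ := by
      simp only [hH, Complex.sub_re, Complex.log_re, Complex.re_ofReal_mul]
      rfl
    have hlogA : |Real.log ‖A‖| ≤ 2 * ε := by
      rw [← Complex.log_re]
      have h2 := norm_log_one_add_sub_le ((hb1 ζ hζ).trans e1)
      have h3 := norm_le_norm_add_norm_sub' (Complex.log A) (ε * ζ)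
      have h4 := hb1 ζ hζ
      refine (Complex.abs_re_le_norm _).trans ?_
      nlinarith [norm_nonneg ((ε : ℂ) * ζ)]
    have hHs := (Complex.abs_re_le_norm _).trans (hHb ζ hζ)
    rw [abs_le] at hlogA hHs
    have hqσ' := abs_le.1 (le_refl |q.2.1|)
    refine ⟨(q.1 + Real.log ‖A‖, q.2.1 + (H ζ).re, q.2.2.1 * (B / ‖B‖), q.2.2.2 * (A / ‖A‖)),
      ⟨⟨by simp only; linarith, by simp only; linarith⟩,
        ⟨by simp only; linarith, by simp only; linarith⟩, ?_, ?_⟩, ?_, ?_, rfl⟩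
    · have : ‖q.2.2.1‖ = 1 := mem_sphere_zero_iff_norm.1 hq.2.2.1
      simp [this, hB0]
    · have : ‖q.2.2.2‖ = 1 := mem_sphere_zero_iff_norm.1 hq.2.2.2
      simp [this, hA0]
    · have hnA : (‖A‖ : ℂ) ≠ 0 := by simpa using hA0
      have hnB : (‖B‖ : ℂ) ≠ 0 := by simpa using hB0
      have hx : x + a * (q.1 + Real.log ‖A‖) + (q.2.1 + (H ζ).re) =
          (x + a * q.1 + q.2.1) + Real.log ‖B‖ := by rw [hHre]; ring
      have hy : y + (q.1 + Real.log ‖A‖) = (y + q.1) + Real.log ‖A‖ := by ring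
      refine Prod.ext ?_ ?_
      · simp only [hΨ, hw, hx, Real.exp_add _ (Real.log _), Real.exp_log (norm_pos_iff.2 hB0),
          Prod.fst_add, Prod.smul_fst, smul_eq_mul, Complex.ofReal_mul]
        field_simp
        rw [hB]; ring
      · simp only [hΨ, hw, hy, Real.exp_add _ (Real.log _), Real.exp_log (norm_pos_iff.2 hA0),
          Prod.snd_add, Prod.smul_snd, smul_eq_mul, Complex.ofReal_mul]
        field_simp
        rw [hA]; ring
    · simp only [← add_assoc]
      rw [Real.exp_add, Real.exp_log (norm_pos_iff.2 hA0), hn2 q hq]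
  have hmv := hu.2 w (a * ε * w.1, ε * w.2) fun ζ hζ => by
    obtain ⟨q', hq', he, -⟩ := hdisc ζ hζ
    rw [← he]
    exact hΨD hq'
  -- Collects the harmonic terms, which average to `0`. What remains is a gain `δ|w₂|²ε²` against a
  -- loss `l (Kε²)²`, and `ε` was chosen so that the gain wins.
  set g : ℂ → ℂ := fun ζ => -(2 * δ * ‖w.2‖ ^ 2 * ε : ℝ) * ζ + (2 * l * q.2.1 : ℝ) * H ζ with hg
  have hHd : DifferentiableOn ℂ H (closedBall 0 1) := by
    intro ζ hζ
    have hζ := mem_closedBall_zero_iff.1 hζ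
    refine DifferentiableAt.differentiableWithinAt ?_
    have d1 : DifferentiableAt ℂ (fun ζ : ℂ => Complex.log (1 + a * (ε * ζ))) ζ :=
      DifferentiableAt.clog (by fun_prop) (one_add_mem_slitPlane ((hb2 ζ hζ).trans e2))
    have d2 : DifferentiableAt ℂ (fun ζ : ℂ => Complex.log (1 + ε * ζ)) ζ :=
      DifferentiableAt.clog (by fun_prop) (one_add_mem_slitPlane ((hb1 ζ hζ).trans e1))
    exact d1.sub (d2.const_mul _)
  have havg := circleAverage_le_of_le_add_re (v := fun ζ : ℂ => u (w + ζ • (a * ε * w.1, ε * w.2)))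
    (g := g) (b := u w - δ * ‖w.2‖ ^ 2 * ε ^ 2 + l * (K * ε ^ 2) ^ 2)
    (hu.1.comp (by fun_prop) fun ζ hζ => by
      obtain ⟨q', hq', he, -⟩ := hdisc ζ (mem_sphere_zero_iff_norm.1 hζ).le
      rw [← he]
      exact hΨD hq')
    (by rw [hg]; exact (by fun_prop : Differentiable ℂ _).differentiableOn.add (hHd.const_mul _))
    (by simp [hg, hH]) (fun ζ hζ => by
      have hζ1 := mem_sphere_zero_iff_norm.1 hζ
      obtain ⟨q', hq', he, hex, hqs⟩ := hdisc ζ hζ1.le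
      have h2 : Φ q' ≤ Φ q := hmax hq'
      simp only [hΦ, he, hex, hqs, ← hn2 q hq, ← hw] at h2
      have h3 : ‖1 + (ε : ℂ) * ζ‖ ^ 2 = 1 + ε ^ 2 + 2 * ε * ζ.re := by
        have h4 : ‖ζ‖ ^ 2 = 1 := by rw [hζ1, one_pow]
        rw [← Complex.normSq_eq_norm_sq, Complex.normSq_apply] at h4 ⊢
        simp only [Complex.add_re, Complex.one_re, Complex.re_ofReal_mul, Complex.add_im,
          Complex.one_im, Complex.im_ofReal_mul]
        linear_combination ε ^ 2 * h4
      have h5 : (g ζ).re = -(2 * δ * ‖w.2‖ ^ 2 * ε) * ζ.re + 2 * l * q.2.1 * (H ζ).re := by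
        simp only [hg, Complex.add_re, ← Complex.ofReal_neg, Complex.re_ofReal_mul]
      have h6 : (H ζ).re ^ 2 ≤ (K * ε ^ 2) ^ 2 :=
        sq_le_sq' (abs_le.1 ((Complex.abs_re_le_norm _).trans (hHb ζ hζ1.le))).1
          (abs_le.1 ((Complex.abs_re_le_norm _).trans (hHb ζ hζ1.le))).2
      have h7 := mul_le_mul_of_nonneg_left h6 hl0.le
      rw [mul_pow, h3] at h2
      rw [h5]
      linarith)
  have hfin := hmv.trans havg
  have h8 : l * (K * ε ^ 2) ^ 2 = l * K ^ 2 * ε ^ 2 * ε ^ 2 := by ring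
  have h9 : 0 < ε ^ 2 := by positivity
  nlinarith

end

section

variable {D : Set (ℂ × ℂ)}

/-- Continuity method: the segment is slid diagonally in logarithmic coordinates by `θ` up to `0`.
The set of `θ` for which it lies in `D` is open; it is closed in `[-τ, 0]` because the maximum
principle keeps these segments in one compact sublevel set of the exhaustion. -/
theorem IsPseudoconvex.expPair_mem (hpc : IsPseudoconvex D) (ho : IsOpen D)
    (hR : IsCompleteReinhardt D) {x y a T : ℝ} (hT : 0 < T) (h0 : expPair x y ∈ D)
    (h1 : expPair (x + a * T) (y + T) ∈ D) {t : ℝ} (ht : t ∈ Icc 0 T) :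
    expPair (x + a * t) (y + t) ∈ D := by
  obtain ⟨u, hu, hcomp⟩ := hpc
  have hfat : ∀ x y : ℝ, expPair x y ∈ D → ∀ᶠ σ in 𝓝 (0 : ℝ), expPair (x + σ) y ∈ D := by
    intro x y hxy
    have : Continuous fun σ : ℝ => expPair (x + σ) y :=
      continuous_expPair (by fun_prop) (by fun_prop)
    exact this.continuousAt.eventually_mem (ho.mem_nhds (by simpa using hxy))
  have hpoly : ∀ x y : ℝ, expPair x y ∈ D → ∃ c, ∀ p : ℂ × ℂ,
      ‖p.1‖ ≤ Real.exp x → ‖p.2‖ ≤ Real.exp y → u p ≤ c := by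
    intro x y hxy
    have hK : IsCompact (closedBall (0 : ℂ) (Real.exp x) ×ˢ closedBall (0 : ℂ) (Real.exp y)) :=
      (isCompact_closedBall _ _).prod (isCompact_closedBall _ _)
    obtain ⟨c, hc⟩ := hK.bddAbove_image (hu.1.mono fun p hp => hR.mem_of_norm_le hxy
      (by simpa [norm_expPair_fst] using hp.1) (by simpa [norm_expPair_snd] using hp.2))
    exact ⟨c, fun p hp1 hp2 => hc (mem_image_of_mem _ ⟨by simpa using hp1, by simpa using hp2⟩)⟩
  obtain ⟨σ₀, ⟨hσa, hσb⟩, hσ₀⟩ := ((((hfat _ _ h0).and (hfat _ _ h1)).filter_mono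
    nhdsWithin_le_nhds).and (self_mem_nhdsWithin (a := (0 : ℝ)) (s := Ioi 0))).exists
  have hσ₀ : 0 < σ₀ := hσ₀
  obtain ⟨c₁, hc₁⟩ := hpoly _ _ hσa
  obtain ⟨c₂, hc₂⟩ := hpoly _ _ hσb
  -- A shift by `-τ` puts the whole segment below its endpoint `(x, y)` in both coordinates, so it
  -- starts inside `D`.
  set τ := T * (1 + |a|) with hτ
  have hτ0 : 0 ≤ τ := by positivity
  set E : ℝ → ℝ → ℂ × ℂ := fun θ t => expPair (x + θ + a * t) (y + θ + t) with hE
  have hEc : Continuous fun p : ℝ × ℝ => E p.1 p.2 :=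
    continuous_expPair (by fun_prop) (by fun_prop)
  set S : Set ℝ := {θ | ∀ t ∈ Icc 0 T, E θ t ∈ D} with hS
  have hSo : IsOpen S := by
    rw [isOpen_iff_mem_nhds]
    intro θ hθ
    refine isCompact_Icc.eventually_forall_of_forall_eventually
      (P := fun θ t => E θ t ∈ D) fun t ht => ?_
    exact hEc.continuousAt.eventually_mem (ho.mem_nhds (hθ t ht))
  have hub : ∀ θ ∈ S, θ ≤ 0 → ∀ t ∈ Icc 0 T, u (E θ t) ≤ max c₁ c₂ := by
    intro θ hθ hθ0 t ht
    have hev : ∀ᶠ σ in 𝓝 (0 : ℝ), ∀ t ∈ Icc 0 T, expPair (x + θ + a * t + σ) (y + θ + t) ∈ D := by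
      refine isCompact_Icc.eventually_forall_of_forall_eventually
        (P := fun σ t => expPair (x + θ + a * t + σ) (y + θ + t) ∈ D) fun t ht => ?_
      have : Continuous fun p : ℝ × ℝ => expPair (x + θ + a * p.2 + p.1) (y + θ + p.2) :=
        continuous_expPair (by fun_prop) (by fun_prop)
      exact this.continuousAt.eventually_mem (ho.mem_nhds (by simpa using hθ t ht))
    obtain ⟨σ, ⟨hσ1, hσ2⟩, hσ0⟩ := (((hev.and (eventually_mem_set.2 (Iio_mem_nhds hσ₀))).filter_mono
      nhdsWithin_le_nhds).and (self_mem_nhdsWithin (a := (0 : ℝ)) (s := Ioi 0))).exists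
    have hσ2 : σ < σ₀ := hσ2
    refine hu.le_of_le_endpoints hR hσ0 hσ1 (fun p hp1 hp2 => ?_) (fun p hp1 hp2 => ?_) ht
    · refine (hc₁ p (hp1.trans (Real.exp_le_exp.2 ?_)) (hp2.trans (Real.exp_le_exp.2 ?_))).trans
        (le_max_left _ _) <;> linarith
    · refine (hc₂ p (hp1.trans (Real.exp_le_exp.2 ?_)) (hp2.trans (Real.exp_le_exp.2 ?_))).trans
        (le_max_right _ _) <;> linarith
  have hclosed : IsClosed (S ∩ Icc (-τ) 0) := by
    have : S ∩ Icc (-τ) 0 =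
        (⋂ t ∈ Icc 0 T, (fun θ => E θ t) ⁻¹' {z | z ∈ D ∧ u z ≤ max c₁ c₂}) ∩ Icc (-τ) 0 := by
      ext θ
      simp only [mem_inter_iff, mem_iInter, mem_preimage, hS]
      constructor
      · rintro ⟨h, hI⟩
        exact ⟨fun t ht => ⟨h t ht, hub θ h hI.2 t ht⟩, hI⟩
      · rintro ⟨h, hI⟩
        exact ⟨fun t ht => (h t ht).1, hI⟩
    rw [this]
    refine IsClosed.inter (isClosed_biInter fun t _ => (hcomp _).isClosed.preimage ?_) isClosed_Icc
    exact hEc.comp (by fun_prop : Continuous fun θ : ℝ => (θ, t))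
  have hstart : -τ ∈ S := by
    intro t ht
    refine hR.mem_of_norm_le h0 ?_ ?_
    · rw [norm_expPair_fst, norm_expPair_fst]
      refine Real.exp_le_exp.2 ?_
      have h2 : a * t ≤ |a| * T :=
        mul_le_mul (le_abs_self a) ht.2 ht.1 (abs_nonneg a)
      rw [hτ]
      nlinarith [ht.1]
    · rw [norm_expPair_snd, norm_expPair_snd]
      refine Real.exp_le_exp.2 ?_
      have : 0 ≤ T * |a| := by positivity
      rw [hτ]
      linarith [ht.2]
  have hend : (0 : ℝ) ∈ S := by
    refine hclosed.mem_of_ge_of_forall_exists_gt (a := -τ) (b := 0)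
      hstart (by linarith) ?_
    rintro θ ⟨hθ, hθI⟩
    have h2 : ∀ᶠ θ' in 𝓝[>] θ, θ' ∈ S := hSo.eventually_mem hθ |>.filter_mono nhdsWithin_le_nhds
    obtain ⟨θ', h3, h4⟩ := (h2.and (eventually_mem_set.2 (Ioc_mem_nhdsGT hθI.2))).exists
    exact ⟨θ', h3, h4⟩
  simpa [hE] using hend t ht

/-! ### Finite contact: a second left inverse -/

/-- For `|w| < d` finite contact suffices, since `|z| ^ n ≤ 1`. For `|w| ≥ d` one has `|z| ≤ r₀ <
1`, and the logarithmic segment from `(r₁, s)` to the point must fall from `r₁` to at most `r₀`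
before `|w| = d`. This forces a negative slope `a`, and `n` is taken so large that `k + n a ≤ 0`. -/
theorem HasFiniteContact.exists_monomial_bound (hfin : HasFiniteContact D)
    (hpc : IsPseudoconvex D) (ho : IsOpen D)
    (hR : IsCompleteReinhardt D) (hD1 : ∀ p ∈ D, ‖p.1‖ < 1)
    (hfr : ((1, 0) : ℂ × ℂ) ∈ frontier D) :
    ∃ (n k : ℕ) (ε : ℝ), 0 < ε ∧ 1 ≤ n ∧ 1 ≤ k ∧ ∀ p ∈ D, ‖p.1‖ + ε * (‖p.1‖ ^ n * ‖p.2‖ ^ k) < 1 := by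
  obtain ⟨k, hk, c, hc, δ, hδ, hcon⟩ := hfin
  -- `d ≤ 1` makes `log s ≤ 0` for the later `s < d`.
  set d := min (δ / 2) 1 with hd
  have hd0 : 0 < d := by positivity
  have hdδ : d < δ := lt_of_le_of_lt (min_le_left _ _) (by linarith)
  set r₀ := max (1 - c * d ^ k) (1 / 2) with hr₀
  have hr₀1 : r₀ < 1 := max_lt (by have : 0 < c * d ^ k := by positivity
                                   linarith) (by norm_num)
  have hr₀0 : 0 < r₀ := lt_of_lt_of_le (by norm_num) (le_max_right _ _)
  have hbig : ∀ p ∈ D, d ≤ ‖p.2‖ → ‖p.1‖ ≤ r₀ := by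
    intro p hp hdp
    have h1 := hcon p.1 d (by rwa [Complex.norm_real, Real.norm_of_nonneg hd0.le])
      (hR.mem_of_norm_le hp le_rfl (by
        simpa only [Complex.norm_real, Real.norm_of_nonneg hd0.le] using hdp))
    rw [Complex.norm_real, Real.norm_of_nonneg hd0.le] at h1
    exact h1.le.trans (le_max_left _ _)
  set r₁ := (r₀ + 1) / 2 with hr₁
  have hr₁0 : 0 < r₁ := by rw [hr₁]; linarith
  obtain ⟨s, ⟨hsD, hsd⟩, hs0⟩ : ∃ s : ℝ, ((((r₁ : ℂ), (s : ℂ)) : ℂ × ℂ) ∈ D ∧ s < d) ∧ 0 < s := by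
    have h1 : Continuous fun s : ℝ => (((r₁ : ℂ), (s : ℂ)) : ℂ × ℂ) := by fun_prop
    have h2 : ∀ᶠ s : ℝ in 𝓝 0, (((r₁ : ℂ), (s : ℂ)) : ℂ × ℂ) ∈ D := by
      refine h1.continuousAt.eventually_mem (ho.mem_nhds ?_)
      rw [Complex.ofReal_zero]
      refine hR.disc_mem hfr ?_
      rw [Complex.norm_real, Real.norm_of_nonneg hr₁0.le, hr₁]
      linarith
    exact (((h2.and (eventually_mem_set.2 (Iio_mem_nhds hd0))).filter_mono
      nhdsWithin_le_nhds).and (self_mem_nhdsWithin (a := (0 : ℝ)) (s := Ioi 0))).exists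
  have hds : 0 < Real.log d - Real.log s := sub_pos.2 (Real.log_lt_log hs0 hsd)
  have hrr : 0 < Real.log r₁ - Real.log r₀ := sub_pos.2 (Real.log_lt_log hr₀0 (by rw [hr₁]; linarith))
  obtain ⟨n, hn⟩ := exists_nat_ge (k * ((Real.log d - Real.log s) / (Real.log r₁ - Real.log r₀)) + 1)
  have hn1 : 1 ≤ n := by
    have : (0 : ℝ) ≤ k * ((Real.log d - Real.log s) / (Real.log r₁ - Real.log r₀)) := by positivity
    have : (1 : ℝ) ≤ n := by linarith
    exact_mod_cast this
  have hmono : ∀ p ∈ D, d ≤ ‖p.2‖ → ‖p.1‖ ^ n * ‖p.2‖ ^ k ≤ 1 := by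
    intro p hp hdp
    rcases eq_or_ne p.1 0 with h0 | h0
    · rw [h0, norm_zero, zero_pow (by omega), zero_mul]
      exact zero_le_one
    have hp1 : 0 < ‖p.1‖ := norm_pos_iff.2 h0
    have hp2 : 0 < ‖p.2‖ := hd0.trans_le hdp
    set T := Real.log ‖p.2‖ - Real.log s with hT
    have hT0 : Real.log d - Real.log s ≤ T := by
      have := Real.log_le_log hd0 hdp
      linarith
    have hTpos : 0 < T := hds.trans_le hT0
    set a := (Real.log ‖p.1‖ - Real.log r₁) / T with ha
    have haT : a * T = Real.log ‖p.1‖ - Real.log r₁ := by rw [ha]; field_simp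
    have h2 := hpc.expPair_mem ho hR (x := Real.log r₁) (y := Real.log s) (a := a) hTpos
      (by rw [expPair, Real.exp_log hr₁0, Real.exp_log hs0]; exact hsD)
      (by
        rw [haT, hT, add_sub_cancel, add_sub_cancel, expPair, Real.exp_log hp1, Real.exp_log hp2]
        exact (hR.mem_congr (q := p) (by simp) (by simp)).2 hp)
      (t := Real.log d - Real.log s) ⟨hds.le, hT0⟩
    have h3 := hbig _ h2 (by rw [norm_expPair_snd, add_sub_cancel, Real.exp_log hd0])
    rw [norm_expPair_fst, ← Real.le_log_iff_exp_le hr₀0] at h3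
    -- `h3` bounds the slope `a`
    have hslope : a * (Real.log d - Real.log s) ≤ -(Real.log r₁ - Real.log r₀) := by linarith
    have hlogr₁ : Real.log r₁ ≤ 0 := Real.log_nonpos hr₁0.le (by rw [hr₁]; linarith)
    have hlogs : Real.log s ≤ 0 :=
      Real.log_nonpos hs0.le (hsd.le.trans (min_le_right _ _))
    have hna : k + n * a ≤ 0 := by
      have h4 : k * (Real.log d - Real.log s) ≤ n * (Real.log r₁ - Real.log r₀) := by
        have h5 : k * ((Real.log d - Real.log s) / (Real.log r₁ - Real.log r₀)) ≤ n := by linarith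
        rwa [← mul_div_assoc, div_le_iff₀ hrr] at h5
      have h6 : (k + n * a) * (Real.log d - Real.log s) ≤ 0 := by
        have := mul_le_mul_of_nonneg_left hslope (Nat.cast_nonneg (α := ℝ) n)
        nlinarith
      by_contra! hpos
      have := mul_pos hpos hds
      linarith
    have hlog : n * Real.log ‖p.1‖ + k * Real.log ‖p.2‖ ≤ 0 := by
      have h7 : Real.log ‖p.1‖ = Real.log r₁ + a * T := by rw [haT]; ring
      have h8 : Real.log ‖p.2‖ = Real.log s + T := by rw [hT]; ring
      have h9 := mul_nonneg_of_nonpos_of_nonpos hna (neg_nonpos.2 hTpos.le)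
      have h10 := mul_nonpos_of_nonneg_of_nonpos (Nat.cast_nonneg (α := ℝ) n) hlogr₁
      have h11 := mul_nonpos_of_nonneg_of_nonpos (Nat.cast_nonneg (α := ℝ) k) hlogs
      rw [h7, h8]
      nlinarith
    rw [← Real.log_pow, ← Real.log_pow, ← Real.log_mul (by positivity) (by positivity)] at hlog
    exact (Real.log_nonpos_iff (by positivity)).1 hlog
  refine ⟨n, k, min (c / 2) ((1 - r₀) / 2), lt_min (by positivity) (by linarith), hn1, hk,
    fun p hp => ?_⟩
  have hε : 0 < min (c / 2) ((1 - r₀) / 2) := lt_min (by positivity) (by linarith)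
  rcases le_or_gt d ‖p.2‖ with h | h
  · have h1 := hbig p hp h
    have h2 := mul_le_mul_of_nonneg_left (hmono p hp h) hε.le
    have h3 := min_le_right (c / 2) ((1 - r₀) / 2)
    linarith
  · have h1 := hcon p.1 p.2 (h.trans hdδ) hp
    have h2 : ‖p.1‖ ^ n * ‖p.2‖ ^ k ≤ ‖p.2‖ ^ k :=
      mul_le_of_le_one_left (by positivity) (pow_le_one₀ (norm_nonneg _) (hD1 p hp).le)
    have h3 : min (c / 2) ((1 - r₀) / 2) * (‖p.1‖ ^ n * ‖p.2‖ ^ k) ≤ c * ‖p.2‖ ^ k :=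
      mul_le_mul ((min_le_left _ _).trans (by linarith)) h2 (by positivity) hc.le
    linarith

/-- Besides the projection, `z + ε z ^ n w ^ k` is a left inverse: the monomial bound keeps it in
the disc, and `k ≥ 1` makes it equal to `z` on `w = 0`. -/
theorem HasFiniteContact.not_hasUniqueLeftInverse (hfin : HasFiniteContact D)
    (hpc : IsPseudoconvex D) (ho : IsOpen D)
    (hR : IsCompleteReinhardt D) (hfr : ((1, 0) : ℂ × ℂ) ∈ frontier D) :
    ¬ HasUniqueLeftInverse D (fun l : ℂ => (l, 0)) := by
  have hD1 : ∀ p ∈ D, ‖p.1‖ < 1 := fun _ hp => hR.norm_fst_lt_one ho hfr hp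
  obtain ⟨n, k, ε, hε, hn, hk, hb⟩ := hfin.exists_monomial_bound hpc ho hR hD1 hfr
  rintro ⟨F, -, huniq⟩
  have h1 := huniq _ (isLeftInverse_fst hD1)
  have h2 := huniq (fun p => p.1 + ε * (p.1 ^ n * p.2 ^ k)) ⟨by fun_prop, fun p hp => ?_,
    fun l _ => ?_⟩
  · have h3 : ((1 / 2, 0) : ℂ × ℂ) ∈ D := hR.disc_mem hfr (by norm_num)
    have h4 : Continuous fun s : ℝ => ((1 / 2, (s : ℂ)) : ℂ × ℂ) := by fun_prop
    have h5 : ∀ᶠ s : ℝ in 𝓝[>] 0, ((1 / 2, (s : ℂ)) : ℂ × ℂ) ∈ D :=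
      (h4.continuousAt.eventually_mem (ho.mem_nhds (by simpa using h3))).filter_mono
        nhdsWithin_le_nhds
    obtain ⟨s, hs, hs0⟩ := (h5.and self_mem_nhdsWithin).exists
    have hs0 : 0 < s := hs0
    have h6 := (h2 hs).trans (h1 hs).symm
    have h7 : (ε : ℂ) * ((1 / 2) ^ n * (s : ℂ) ^ k) = 0 := by simpa using h6
    have h8 : (ε : ℂ) ≠ 0 := by exact_mod_cast hε.ne'
    have h9 : (s : ℂ) ≠ 0 := by exact_mod_cast hs0.ne'
    simp [h8, h9] at h7
  · rw [mem_ball_zero_iff]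
    refine lt_of_le_of_lt (norm_add_le _ _) ?_
    rw [norm_mul, norm_mul, norm_pow, norm_pow, Complex.norm_real, Real.norm_of_nonneg hε.le]
    exact hb p hp
  · have : k ≠ 0 := by omega
    simp [this]

theorem hasUniqueLeftInverse_iff (hpc : IsPseudoconvex D) (ho : IsOpen D)
    (hR : IsCompleteReinhardt D) (hfr : ((1, 0) : ℂ × ℂ) ∈ frontier D)
    (hs : HasSmoothBoundaryNear D (1, 0)) :
    HasUniqueLeftInverse D (fun l : ℂ => (l, 0)) ↔ IsOfInfiniteTypeAt D (1, 0) := by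
  have hD1 : ∀ p ∈ D, ‖p.1‖ < 1 := fun _ hp => hR.norm_fst_lt_one ho hfr hp
  rw [isOfInfiniteTypeAt_iff_isFlat hs hR hD1 hfr]
  constructor
  · intro huniq
    obtain ⟨U, ρ, h⟩ := hs
    exact (h.isFlat_or_hasFiniteContact hR hD1 hfr).resolve_right fun hfin =>
      hfin.not_hasUniqueLeftInverse hpc ho hR hfr huniq
  · exact fun hflat => ⟨Prod.fst, isLeftInverse_fst hD1,
      fun G hG => hflat.eqOn_fst ho hR hD1 hG⟩

end

/-! ### Uniqueness of complex geodesics under strict convexity -/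

/-- A self-map of the disc fixing `0` which nearly preserves the modulus of one point `σ ≠ 0`
nearly preserves the modulus of any other point. -/
theorem exists_lt_forall_mul_le_norm {σ ζ : ℂ} (hσ : ‖σ‖ < 1) (hσ0 : σ ≠ 0) (hζ : ‖ζ‖ < 1) {ε : ℝ}
    (hε : 0 < ε) : ∃ κ < ‖σ‖, ∀ G : ℂ → ℂ, DifferentiableOn ℂ G (ball 0 1) →
      MapsTo G (ball 0 1) (ball 0 1) → G 0 = 0 → κ < ‖G σ‖ → ‖ζ‖ * (1 - ε) ≤ ‖G ζ‖ := by
  have hm := norm_mob_lt_one hσ hζ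
  set Q := 1 - ‖mob σ ζ‖ ^ 2 with hQ
  have hQ0 : 0 < Q := by rw [hQ]; nlinarith [norm_nonneg (mob σ ζ)]
  -- With `k = G(z) / z` and `|k σ| > 1 - τ` one gets `1 - |k σ|² ≤ 2τ ≤ ε² Q`, and Schwarz–Pick for
  -- `k` then yields `|1 - conj (k σ) · k ζ| ≤ ε`.
  set τ := min 1 (ε ^ 2 * Q / 2) with hτ
  have hτ0 : 0 < τ := by positivity
  have hσpos : 0 < ‖σ‖ := norm_pos_iff.2 hσ0
  refine ⟨‖σ‖ * (1 - τ), by nlinarith, fun G hG hGm hG0 hκ => ?_⟩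
  set k := dslope G 0 with hk
  have hkd : DifferentiableOn ℂ k (ball 0 1) :=
    (Complex.differentiableOn_dslope (ball_mem_nhds _ one_pos)).2 hG
  have hkm : MapsTo k (ball 0 1) (closedBall 0 1) := by
    intro z hz
    have := Complex.norm_dslope_le_div_of_mapsTo_ball (R₂ := 1) hG
      (by rw [hG0]; exact hGm.mono_right ball_subset_closedBall) hz
    simpa using this
  have hGk : ∀ z, ‖G z‖ = ‖z‖ * ‖k z‖ := by
    intro z
    have := sub_smul_dslope G 0 z
    rw [hG0, sub_zero, sub_zero] at this
    rw [← this, norm_smul]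
  have h1 := one_sub_sq_mul_le_of_mapsTo_closedBall hkd hkm hσ hζ
  have hkσ : 1 - τ < ‖k σ‖ := by
    rw [hGk] at hκ
    exact lt_of_mul_lt_mul_left hκ hσpos.le
  have hkσ1 : ‖k σ‖ ≤ 1 := mem_closedBall_zero_iff.1 (hkm (mem_ball_zero_iff.2 hσ))
  have hkζ1 : ‖k ζ‖ ≤ 1 := mem_closedBall_zero_iff.1 (hkm (mem_ball_zero_iff.2 hζ))
  have hτ1 : τ ≤ 1 := min_le_left _ _
  have h2 : (1 - ‖k σ‖ ^ 2) * (1 - ‖k ζ‖ ^ 2) ≤ ε ^ 2 * Q := by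
    have h3 : 1 - ‖k σ‖ ^ 2 ≤ 2 * τ := by nlinarith
    have h4 : τ ≤ ε ^ 2 * Q / 2 := min_le_right _ _
    have h5 : 0 ≤ 1 - ‖k σ‖ ^ 2 := by nlinarith [norm_nonneg (k σ)]
    nlinarith [sq_nonneg ‖k ζ‖]
  have h3 : ‖1 - (starRingEnd ℂ) (k σ) * k ζ‖ ≤ ε := by
    have : Q * ‖1 - (starRingEnd ℂ) (k σ) * k ζ‖ ^ 2 ≤ Q * ε ^ 2 := by linarith
    exact le_of_sq_le_sq (le_of_mul_le_mul_left this hQ0) hε.le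
  have h4 := norm_sub_norm_le (1 : ℂ) ((starRingEnd ℂ) (k σ) * k ζ)
  rw [norm_one, norm_mul, RCLike.norm_conj] at h4
  have h5 : ‖k σ‖ * ‖k ζ‖ ≤ ‖k ζ‖ := mul_le_of_le_one_left (norm_nonneg _) hkσ1
  rw [hGk]
  exact mul_le_mul_of_nonneg_left (by linarith) (norm_nonneg _)

/-- The pseudohyperbolic Carathéodory distance of `p` and `q` is at least `d`. -/
def CaratheodoryGE (D : Set (ℂ × ℂ)) (p q : ℂ × ℂ) (d : ℝ) : Prop :=
  ∀ κ < d, ∃ F : ℂ × ℂ → ℂ, DifferentiableOn ℂ F D ∧ MapsTo F D (ball 0 1) ∧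
    κ < ‖mob (F p) (F q)‖

section

variable {D : Set (ℂ × ℂ)} {f g : ℂ → ℂ × ℂ}

theorem CaratheodoryGE.symm {p q : ℂ × ℂ} {d : ℝ} (h : CaratheodoryGE D p q d) :
    CaratheodoryGE D q p d := by
  intro κ hκ
  obtain ⟨F, h1, h2, h3⟩ := h κ hκ
  exact ⟨F, h1, h2, by rwa [norm_mob_comm]⟩

theorem CaratheodoryGE.le_of_disc (hf : DifferentiableOn ℂ f (ball 0 1))
    (hm : MapsTo f (ball 0 1) D) {a b : ℂ} (ha : ‖a‖ < 1) (hb : ‖b‖ < 1) {d : ℝ}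
    (h : CaratheodoryGE D (f a) (f b) d) : d ≤ ‖mob a b‖ := by
  by_contra! hlt
  obtain ⟨F, h1, h2, h3⟩ := h _ hlt
  exact absurd (norm_mob_image_le (f := F ∘ f) (h1.comp hf hm) (h2.comp hm) ha hb) (not_le.2 h3)

/-- A function nearly extremal for one pair on the disc, normalized by Möbius maps, is a self-map of
the unit disc to which `exists_lt_forall_mul_le_norm` applies; so it is nearly extremal for `a` and
any other point. -/
theorem CaratheodoryGE.of_disc (hf : DifferentiableOn ℂ f (ball 0 1))
    (hm : MapsTo f (ball 0 1) D) {a b ζ : ℂ} (ha : ‖a‖ < 1) (hb : ‖b‖ < 1) (hζ : ‖ζ‖ < 1)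
    (hab : b ≠ a) (h : CaratheodoryGE D (f a) (f b) ‖mob a b‖) :
    CaratheodoryGE D (f a) (f ζ) ‖mob a ζ‖ := by
  intro κ hκ
  set m := ‖mob a ζ‖ with hmdef
  have hm1 : m < 1 := norm_mob_lt_one ha hζ
  obtain ⟨κ', hκ', hQ⟩ := exists_lt_forall_mul_le_norm (norm_mob_lt_one ha hb)
    (fun h0 => hab ((mob_eq_zero_iff ha hb.le).1 h0)) (norm_mob_lt_one ha hζ)
    (ε := (m - κ) / 2) (by linarith)
  obtain ⟨F, h1, h2, h3⟩ := h κ' hκ'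
  have hFa : ‖F (f a)‖ < 1 := mem_ball_zero_iff.1 (h2 (hm (mem_ball_zero_iff.2 ha)))
  have h4 := hQ (mob (F (f a)) ∘ F ∘ f ∘ mob a)
    ((differentiableOn_mob hFa).comp (h1.comp (hf.comp (differentiableOn_mob ha) (mapsTo_mob ha))
      (hm.comp (mapsTo_mob ha))) (h2.comp (hm.comp (mapsTo_mob ha))))
    ((mapsTo_mob hFa).comp (h2.comp (hm.comp (mapsTo_mob ha))))
    (by simp [mob_zero_right, mob_self]) (by simpa [mob_mob ha hb] using h3)
  simp only [Function.comp_apply, mob_mob ha hζ] at h4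
  refine ⟨F, h1, h2, lt_of_lt_of_le ?_ h4⟩
  have : 0 ≤ m := norm_nonneg _
  nlinarith

theorem IsComplexGeodesic.caratheodoryGE (h : IsComplexGeodesic D f) {a b : ℂ} (ha : ‖a‖ < 1)
    (hb : ‖b‖ < 1) : CaratheodoryGE D (f a) (f b) ‖mob a b‖ := by
  obtain ⟨hf, hm, l₁, hl₁, l₂, hl₂, hne, heq⟩ := h
  rw [mem_ball_zero_iff] at hl₁ hl₂
  have hml := norm_mob_lt_one hl₁ hl₂
  have hm0 : 0 < ‖mob l₁ l₂‖ :=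
    norm_pos_iff.2 fun h0 => hne ((mob_eq_zero_iff hl₁ hl₂.le).1 h0).symm
  have h0 : CaratheodoryGE D (f l₁) (f l₂) ‖mob l₁ l₂‖ := by
    intro κ hκ
    -- `κ` may lie below `-1`, outside the range where `artanh` is monotone.
    set κ' := max κ 0 with hκ'
    have hκ'm : κ' < ‖mob l₁ l₂‖ := max_lt hκ hm0
    have hκ'0 : 0 ≤ κ' := le_max_right _ _
    have hlt : ENNReal.ofReal (Real.artanh κ') < caratheodoryDist D (f l₁) (f l₂) := by
      rw [heq, poincareDist_eq_artanh_mob,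
        ENNReal.ofReal_lt_ofReal_iff (Real.artanh_pos ⟨hm0, hml⟩)]
      exact Real.artanh_lt_artanh (by linarith) hml hκ'm
    rw [caratheodoryDist, lt_iSup_iff] at hlt
    obtain ⟨F, hlt⟩ := hlt
    rw [lt_iSup_iff] at hlt
    obtain ⟨⟨h1, h2⟩, hlt⟩ := hlt
    refine ⟨F, h1, h2, lt_of_le_of_lt (le_max_left κ 0) ?_⟩
    by_contra! hle
    refine absurd hlt (not_lt.2 (ENNReal.ofReal_le_ofReal ?_))
    exact Real.artanh_le_artanh (lt_of_lt_of_le (by norm_num) (norm_nonneg _))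
      (hκ'm.trans hml) hle
  have h1 : ∀ ζ : ℂ, ‖ζ‖ < 1 → CaratheodoryGE D (f l₁) (f ζ) ‖mob l₁ ζ‖ :=
    fun ζ hζ => h0.of_disc hf hm hl₁ hl₂ hζ hne.symm
  -- Extremality spreads to all pairs by moving one endpoint at a time.
  rcases eq_or_ne a l₁ with rfl | hal
  · exact h1 b hb
  · have h2 := (h1 a ha).symm
    rw [norm_mob_comm] at h2
    exact h2.of_disc hf hm ha hl₁ hb hal.symm

/-- Holomorphic functions from a balanced domain to the disc stay uniformly away from the unit
circle on the shrunken domain `r • D`. -/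
theorem norm_mob_sq_le_of_balanced (hbal : ∀ p ∈ D, ∀ c : ℂ, ‖c‖ ≤ 1 → c • p ∈ D)
    {F : ℂ × ℂ → ℂ} (hF : DifferentiableOn ℂ F D) (hFm : MapsTo F D (ball 0 1)) {p q : ℂ × ℂ}
    (hp : p ∈ D) (hq : q ∈ D) {r s : ℝ} (hr0 : 0 ≤ r) (hr : r < 1) (hs0 : 0 ≤ s) (hs : s < 1) :
    ‖mob (F ((s : ℂ) • p)) (F ((r : ℂ) • q))‖ ^ 2 ≤ 1 - (1 - r ^ 2) * (1 - s) ^ 2 := by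
  have hns : ‖(s : ℂ)‖ = s := by rw [Complex.norm_real, Real.norm_of_nonneg hs0]
  have hnr : ‖(r : ℂ)‖ = r := by rw [Complex.norm_real, Real.norm_of_nonneg hr0]
  have hFw : ‖F ((s : ℂ) • p)‖ < 1 :=
    mem_ball_zero_iff.1 (hFm (hbal p hp _ (by rw [hns]; exact hs.le)))
  set G : ℂ × ℂ → ℂ := mob (F ((s : ℂ) • p)) ∘ F with hG
  have hGd : DifferentiableOn ℂ G D := (differentiableOn_mob hFw).comp hF hFm
  have hGm : MapsTo G D (ball 0 1) := (mapsTo_mob hFw).comp hFm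
  -- The points `s • p` and `r • q` are joined through the origin, with Schwarz–Pick on each of the
  -- two complex lines.
  have hline : ∀ v ∈ D, ∀ a b : ℂ, ‖a‖ < 1 → ‖b‖ < 1 → ‖mob (G (a • v)) (G (b • v))‖ ≤ ‖mob a b‖ := by
    intro v hv a b ha hb
    have hmv : MapsTo (fun c : ℂ => c • v) (ball 0 1) D :=
      fun c hc => hbal v hv c (mem_ball_zero_iff.1 hc).le
    exact norm_mob_image_le (f := fun c : ℂ => G (c • v)) (hGd.comp (by fun_prop) hmv)
      (hGm.comp hmv) ha hb
  have h1 := hline p hp s 0 (by rwa [hns]) (by simp)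
  have hGs : G ((s : ℂ) • p) = 0 := by simp [hG, mob_self]
  rw [hGs, norm_mob_zero_left, mob_zero_right, hns, zero_smul] at h1
  have h2 := hline q hq 0 r (by simp) (by rwa [hnr])
  rw [norm_mob_zero_left, hnr, zero_smul] at h2
  change ‖G ((r : ℂ) • q)‖ ^ 2 ≤ _
  set A := G 0 with hA
  set B := G ((r : ℂ) • q) with hB
  have hB1 : ‖B‖ < 1 := mem_ball_zero_iff.1 (hGm (hbal q hq _ (by rw [hnr]; exact hr.le)))
  have hA1 : ‖A‖ < 1 := h1.trans_lt hs
  have h3 := one_sub_norm_mob_sq hA1 hB1.le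
  have h4 : 1 - r ^ 2 ≤ 1 - ‖mob A B‖ ^ 2 := by
    have := pow_le_pow_left₀ (norm_nonneg _) h2 2
    linarith
  have h5 : 1 - s ≤ ‖1 - (starRingEnd ℂ) A * B‖ := by
    have h6 := norm_sub_norm_le (1 : ℂ) ((starRingEnd ℂ) A * B)
    rw [norm_one, norm_mul, RCLike.norm_conj] at h6
    have : ‖A‖ * ‖B‖ ≤ ‖A‖ := mul_le_of_le_one_right (norm_nonneg _) hB1.le
    linarith
  have h5' : 0 < ‖1 - (starRingEnd ℂ) A * B‖ := by linarith
  rw [h3, le_div_iff₀ (by positivity)] at h4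
  have h7 : (1 - s) ^ 2 ≤ ‖1 - (starRingEnd ℂ) A * B‖ ^ 2 :=
    pow_le_pow_left₀ (by linarith) h5 2
  have h8 : 0 ≤ 1 - r ^ 2 := by nlinarith
  have h9 := mul_le_mul_of_nonneg_left h7 h8
  have h10 : (1 - ‖A‖ ^ 2) * (1 - ‖B‖ ^ 2) ≤ 1 - ‖B‖ ^ 2 :=
    mul_le_of_le_one_left (by nlinarith [norm_nonneg B]) (by nlinarith [sq_nonneg ‖A‖])
  linarith

/-- Uniform strict convexity of a balanced set: midpoints of points of `D` at distance at least `ε`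
from each other lie in `r • D` for some `r < 1`. -/
def IsUniformlyMidpointConvex (D : Set (ℂ × ℂ)) : Prop :=
  ∀ ε : ℝ, 0 < ε → ∃ r : ℝ, 0 ≤ r ∧ r < 1 ∧ ∀ x ∈ D, ∀ y ∈ D, ε ≤ ‖x - y‖ →
    ∃ q ∈ D, (1 / 2 : ℂ) • (x + y) = (r : ℂ) • q

/-- The midpoint disc `h = (f + g) / 2` agrees with `f` at `0` and `β`, so nearly extremal functions
separate `h 0` and `h ζ` by almost `|ζ|`. As `|ζ| → 1` this forbids `h ζ ∈ r • D`, hence `f` and `g`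
are uniformly close near the circle, and the maximum principle finishes. -/
theorem IsUniformlyMidpointConvex.eqOn (hD : IsUniformlyMidpointConvex D) (ho : IsOpen D)
    (hbal : ∀ p ∈ D, ∀ c : ℂ, ‖c‖ ≤ 1 → c • p ∈ D)
    (hconv : ∀ x ∈ D, ∀ y ∈ D, (1 / 2 : ℂ) • (x + y) ∈ D)
    (hf : DifferentiableOn ℂ f (ball 0 1)) (hfm : MapsTo f (ball 0 1) D)
    (hg : DifferentiableOn ℂ g (ball 0 1)) (hgm : MapsTo g (ball 0 1) D)
    (h0 : f 0 = g 0) {β : ℂ} (hβ : ‖β‖ < 1) (hβ0 : β ≠ 0) (hfβ : f β = g β)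
    (hC : CaratheodoryGE D (f 0) (f β) ‖β‖) : EqOn f g (ball 0 1) := by
  have h0D : f 0 ∈ D := hfm (by simp)
  obtain ⟨s, hs0, hs1, p, hp, hsp⟩ : ∃ s : ℝ, 0 ≤ s ∧ s < 1 ∧ ∃ p ∈ D, (s : ℂ) • p = f 0 := by
    have h1 : ContinuousAt (fun s : ℝ => ((s⁻¹ : ℝ) : ℂ) • f 0) 1 := by
      have : ContinuousAt (fun s : ℝ => s⁻¹) 1 := continuousAt_inv₀ one_ne_zero
      exact (Complex.continuous_ofReal.continuousAt.comp this).smul continuousAt_const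
    have h2 : ∀ᶠ s : ℝ in 𝓝[<] 1, ((s⁻¹ : ℝ) : ℂ) • f 0 ∈ D :=
      (h1.eventually_mem (ho.mem_nhds (by simpa using h0D))).filter_mono nhdsWithin_le_nhds
    obtain ⟨s, hs, hs'⟩ := (h2.and (eventually_mem_set.2 (Ioo_mem_nhdsLT zero_lt_one))).exists
    have hs0 : (s : ℂ) ≠ 0 := by exact_mod_cast hs'.1.ne'
    exact ⟨s, hs'.1.le, hs'.2, _, hs, by
      rw [Complex.ofReal_inv, smul_smul, mul_inv_cancel₀ hs0, one_smul]⟩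
  set h : ℂ → ℂ × ℂ := fun ζ => (1 / 2 : ℂ) • (f ζ + g ζ) with hh
  have hhd : DifferentiableOn ℂ h (ball 0 1) := (hf.fun_add hg).fun_const_smul (1 / 2 : ℂ)
  have hhm : MapsTo h (ball 0 1) D := fun ζ hζ => hconv _ (hfm hζ) _ (hgm hζ)
  have hhalf : ∀ x : ℂ × ℂ, (1 / 2 : ℂ) • (x + x) = x := by
    intro x
    rw [← two_smul ℂ x, smul_smul]
    norm_num
  have hh0 : h 0 = f 0 := by simp only [hh, ← h0, hhalf]
  have hhβ : h β = f β := by simp only [hh, ← hfβ, hhalf]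
  have key : ∀ ε : ℝ, 0 < ε → ∃ R₀ : ℝ, R₀ < 1 ∧ ∀ ζ : ℂ, R₀ < ‖ζ‖ → ‖ζ‖ < 1 → ‖f ζ - g ζ‖ ≤ ε := by
    intro ε hε
    obtain ⟨r, hr0, hr1, hr⟩ := hD ε hε
    set C := 1 - (1 - r ^ 2) * (1 - s) ^ 2 with hCdef
    have hC1 : C < 1 := by
      have h1 : 0 < 1 - r ^ 2 := by nlinarith
      have h2 : 0 < 1 - s := by linarith
      have : 0 < (1 - r ^ 2) * (1 - s) ^ 2 := by positivity
      linarith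
    refine ⟨√C, by rw [Real.sqrt_lt' one_pos]; simpa using hC1, fun ζ hζ hζ1 => ?_⟩
    by_contra! hlt
    obtain ⟨q, hq, hqm⟩ := hr _ (hfm (mem_ball_zero_iff.2 hζ1)) _ (hgm (mem_ball_zero_iff.2 hζ1))
      hlt.le
    -- Then `‖ζ‖ (1 - e) ≥ ‖ζ‖ - e > √C`, contradicting the balanced-domain bound.
    set e := (‖ζ‖ - √C) / 2 with he
    obtain ⟨κ, hκ, hQ⟩ := exists_lt_forall_mul_le_norm hβ hβ0 hζ1 (ε := e) (by linarith)
    obtain ⟨F, h1, h2, h3⟩ := hC κ hκ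
    have hFw : ‖F (f 0)‖ < 1 := mem_ball_zero_iff.1 (h2 h0D)
    have h4 := hQ (mob (F (f 0)) ∘ F ∘ h) ((differentiableOn_mob hFw).comp (h1.comp hhd hhm)
      (h2.comp hhm)) ((mapsTo_mob hFw).comp (h2.comp hhm)) (by simp [hh0, mob_self])
      (by simpa [hhβ] using h3)
    have h5 := norm_mob_sq_le_of_balanced hbal h1 h2 hp hq hr0 hr1 hs0 hs1
    rw [hsp, ← hqm] at h5
    simp only [Function.comp_apply, hh] at h4
    have h6 := Real.abs_le_sqrt h5
    rw [abs_of_nonneg (norm_nonneg _)] at h6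
    have h7 := h4.trans h6
    nlinarith
  intro ζ₀ hζ₀
  rw [mem_ball_zero_iff] at hζ₀
  rw [← sub_eq_zero, ← norm_le_zero_iff]
  refine le_of_forall_pos_le_add fun ε hε => ?_
  rw [zero_add]
  obtain ⟨R₀, hR₀, hR⟩ := key ε hε
  obtain ⟨R, hR1, hR2⟩ := exists_between (max_lt hR₀ hζ₀)
  have hRpos : 0 < R := (norm_nonneg ζ₀).trans_lt ((le_max_right _ _).trans_lt hR1)
  have hcl : closure (ball (0 : ℂ) R) ⊆ ball 0 1 := by
    rw [closure_ball _ hRpos.ne']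
    exact closedBall_subset_ball hR2
  refine Complex.norm_le_of_forall_mem_frontier_norm_le (f := fun ζ => f ζ - g ζ)
    (isBounded_ball (x := 0) (r := R))
    (DifferentiableOn.diffContOnCl ((hf.sub hg).mono hcl)) (fun ξ hξ => ?_)
    (subset_closure (mem_ball_zero_iff.2 ((le_max_right _ _).trans_lt hR1)))
  rw [frontier_ball _ hRpos.ne', mem_sphere_zero_iff_norm] at hξ
  exact hR ξ (by rw [hξ]; exact (le_max_left _ _).trans_lt hR1) (by rwa [hξ])

/-- Both parameter pairs have the same pseudohyperbolic distance, so Möbius maps and a rotation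
bring both geodesics to the same values at `0` and `β`. -/
theorem IsUniformlyMidpointConvex.hasUniqueGeodesics (hD : IsUniformlyMidpointConvex D)
    (ho : IsOpen D) (hbal : ∀ p ∈ D, ∀ c : ℂ, ‖c‖ ≤ 1 → c • p ∈ D)
    (hconv : ∀ x ∈ D, ∀ y ∈ D, (1 / 2 : ℂ) • (x + y) ∈ D) : HasUniqueGeodesics D := by
  rintro f g hf hg w z hwz ⟨a₁, ha₁, hfa₁⟩ ⟨a₂, ha₂, hfa₂⟩ ⟨b₁, hb₁, hgb₁⟩ ⟨b₂, hb₂, hgb₂⟩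
  rw [mem_ball_zero_iff] at ha₁ ha₂ hb₁ hb₂
  have hCf := hf.caratheodoryGE ha₁ ha₂
  have hCg := hg.caratheodoryGE hb₁ hb₂
  rw [hfa₁, hfa₂] at hCf
  rw [hgb₁, hgb₂] at hCg
  have heq : ‖mob a₁ a₂‖ = ‖mob b₁ b₂‖ := by
    refine le_antisymm ?_ ?_
    · exact CaratheodoryGE.le_of_disc hg.1 hg.2.1 hb₁ hb₂ (by rwa [hgb₁, hgb₂])
    · exact CaratheodoryGE.le_of_disc hf.1 hf.2.1 ha₁ ha₂ (by rwa [hfa₁, hfa₂])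
  set α := mob a₁ a₂ with hα
  set β := mob b₁ b₂ with hβ
  have hβ1 : ‖β‖ < 1 := norm_mob_lt_one hb₁ hb₂
  have hβ0 : β ≠ 0 := by
    intro h0
    have := (mob_eq_zero_iff hb₁ hb₂.le).1 h0
    exact hwz (by rw [← hgb₁, ← hgb₂, this])
  set c := α / β with hc
  have hc1 : ‖c‖ = 1 := by rw [hc, norm_div, heq, div_self (norm_ne_zero_iff.2 hβ0)]
  have hcβ : c * β = α := div_mul_cancel₀ _ hβ0
  have ha : IsDiscAutomorphism (mob a₁ ∘ fun z => c * z) :=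
    (isDiscAutomorphism_mob ha₁).comp (isDiscAutomorphism_const_mul hc1)
  have hb : IsDiscAutomorphism (mob b₁) := isDiscAutomorphism_mob hb₁
  have e1 : f ((mob a₁ ∘ fun z => c * z) 0) = w := by
    simp [mob_zero_right, hfa₁]
  have e2 : f ((mob a₁ ∘ fun z => c * z) β) = z := by
    simp [hcβ, hα, mob_mob ha₁ ha₂, hfa₂]
  have e3 : g (mob b₁ 0) = w := by rw [mob_zero_right, hgb₁]
  have e4 : g (mob b₁ β) = z := by rw [hβ, mob_mob hb₁ hb₂, hgb₂]
  have hE := hD.eqOn (f := f ∘ (mob a₁ ∘ fun z => c * z)) (g := g ∘ mob b₁) ho hbal hconv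
    (hf.1.comp ha.1 ha.2.mapsTo) (hf.2.1.comp ha.2.mapsTo)
    (hg.1.comp hb.1 hb.2.mapsTo) (hg.2.1.comp hb.2.mapsTo)
    (e1.trans e3.symm) hβ1 hβ0 (e2.trans e4.symm) (by
      simp only [Function.comp_apply] at e1 e2 ⊢
      rwa [e1, e2])
  refine ⟨(mob a₁ ∘ fun z => c * z) ∘ mob b₁, ha.comp hb, fun ξ hξ => ?_⟩
  have := hE (mapsTo_mob hb₁ hξ)
  simp only [Function.comp_apply, mob_mob hb₁ (mem_ball_zero_iff.1 hξ)] at this ⊢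
  exact this.symm

end

/-! ### The strictly convex example -/

theorem expNegInvGlue_strictMonoOn : StrictMonoOn expNegInvGlue (Ici 0) := by
  intro s hs t _ hst
  rcases eq_or_lt_of_le (show 0 ≤ s from hs) with rfl | hs
  · rw [expNegInvGlue.zero]
    exact expNegInvGlue.pos_of_pos hst
  · rw [expNegInvGlue, expNegInvGlue, if_neg (not_le.2 hs), if_neg (not_le.2 (hs.trans hst))]
    exact Real.exp_lt_exp.2 (neg_lt_neg (inv_strictAnti₀ hs hst))

theorem expNegInvGlue_le_factorial_mul_pow {t : ℝ} (ht : 0 ≤ t) (n : ℕ) :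
    expNegInvGlue t ≤ n.factorial * t ^ n := by
  rcases eq_or_lt_of_le ht with rfl | ht
  · rw [expNegInvGlue.zero]
    positivity
  · rw [expNegInvGlue, if_neg (not_le.2 ht), Real.exp_neg,
      inv_le_comm₀ (Real.exp_pos _) (by positivity)]
    have := Real.pow_div_factorial_le_exp t⁻¹ (by positivity) n
    refine le_trans (le_of_eq ?_) this
    rw [inv_pow, mul_inv]
    field_simp

/-- For `x > 0` the second derivative is `(x⁻⁴ - 2x⁻³) exp(-1/x)`, nonnegative exactly for `x ≤
1/2`. -/
theorem convexOn_expNegInvGlue : ConvexOn ℝ (Icc 0 (1 / 2)) expNegInvGlue := by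
  have h1 : deriv expNegInvGlue =
      fun x => (Polynomial.X ^ 2 : Polynomial ℝ).eval x⁻¹ * expNegInvGlue x := by
    funext x
    have := (expNegInvGlue.hasDerivAt_polynomial_eval_inv_mul 1 x).deriv
    simpa using this
  have h2 : ∀ x, deriv (deriv expNegInvGlue) x = x⁻¹ ^ 2 * (x⁻¹ ^ 2 - 2 * x⁻¹) * expNegInvGlue x := by
    intro x
    rw [h1, (expNegInvGlue.hasDerivAt_polynomial_eval_inv_mul (Polynomial.X ^ 2) x).deriv]
    simp [one_add_one_eq_two]
  refine convexOn_of_deriv2_nonneg (convex_Icc _ _)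
    (expNegInvGlue.contDiff (n := 1)).continuous.continuousOn
    ((expNegInvGlue.contDiff (n := 1)).differentiable (by simp)).differentiableOn ?_ ?_
  · rw [h1]
    exact (expNegInvGlue.differentiable_polynomial_eval_inv_mul _).differentiableOn
  · intro x hx
    rw [interior_Icc] at hx
    have hx2 : 2 ≤ x⁻¹ := by
      rw [le_inv_comm₀ (by norm_num) hx.1]
      linarith [hx.2]
    simp only [Function.iterate_succ, Function.iterate_zero, Function.comp_apply, id_eq]
    rw [h2]
    refine mul_nonneg (mul_nonneg (by positivity) (by nlinarith)) (expNegInvGlue.nonneg x)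

/-- The defining function of a strictly convex complete Reinhardt domain whose boundary is flat
at `(1, 0)`. -/
noncomputable def flatRho (p : ℂ × ℂ) : ℝ :=
  ‖p.1‖ ^ 2 + Real.exp 2 * expNegInvGlue (‖p.2‖ ^ 2) - 1

theorem contDiff_flatRho : ContDiff ℝ ∞ flatRho := by
  unfold flatRho
  have h1 : ContDiff ℝ ∞ fun p : ℂ × ℂ => ‖p.1‖ ^ 2 := contDiff_fst.norm_sq ℝ
  have h2 : ContDiff ℝ ∞ fun p : ℂ × ℂ => ‖p.2‖ ^ 2 := contDiff_snd.norm_sq ℝ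
  exact (h1.add (contDiff_const.mul ((expNegInvGlue.contDiff (n := ⊤)).comp h2))).sub contDiff_const

/-- This normalization explains the factor `e²`: it confines the closed domain to `|w|² ≤ 1/2`, the
range where `expNegInvGlue` is convex. -/
theorem exp_two_mul_expNegInvGlue_half : Real.exp 2 * expNegInvGlue (1 / 2) = 1 := by
  rw [expNegInvGlue, if_neg (by norm_num), ← Real.exp_add]
  norm_num

theorem norm_sq_snd_le_of_flatRho_nonpos {p : ℂ × ℂ} (hp : flatRho p ≤ 0) : ‖p.2‖ ^ 2 ≤ 1 / 2 := by
  by_contra! hlt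
  have h1 := expNegInvGlue_strictMonoOn (show (1 / 2 : ℝ) ∈ Ici 0 by norm_num [mem_Ici])
    (mem_Ici.2 (sq_nonneg ‖p.2‖)) hlt
  have h2 := mul_lt_mul_of_pos_left h1 (Real.exp_pos 2)
  rw [exp_two_mul_expNegInvGlue_half] at h2
  rw [flatRho] at hp
  have := sq_nonneg ‖p.1‖
  linarith

theorem norm_fst_sq_le_of_flatRho {p : ℂ × ℂ} : ‖p.1‖ ^ 2 ≤ flatRho p + 1 := by
  rw [flatRho]
  have := mul_nonneg (Real.exp_pos 2).le (expNegInvGlue.nonneg (‖p.2‖ ^ 2))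
  linarith

theorem norm_sq_convex_combination {a b : ℝ} (hab : a + b = 1) (z w : ℂ) :
    ‖a • z + b • w‖ ^ 2 = a * ‖z‖ ^ 2 + b * ‖w‖ ^ 2 - a * b * ‖z - w‖ ^ 2 := by
  obtain rfl : b = 1 - a := by linarith
  simp only [← Complex.normSq_eq_norm_sq, Complex.normSq_apply, Complex.sub_re, Complex.sub_im,
    Complex.add_re, Complex.add_im, Complex.smul_re, Complex.smul_im, smul_eq_mul]
  ring

/-- Squared norms lose `d₁` and `d₂` under convex combination. If the first coordinates differ, `d₁
> 0`; otherwise `d₂ > 0` and strict monotonicity of `expNegInvGlue` gives the strict inequality. -/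
theorem flatRho_lt_of_ne {p q : ℂ × ℂ} (hp : flatRho p ≤ 0) (hq : flatRho q ≤ 0) (hpq : p ≠ q)
    {a b : ℝ} (ha : 0 < a) (hb : 0 < b) (hab : a + b = 1) :
    flatRho (a • p + b • q) < a * flatRho p + b * flatRho q := by
  have hp2 := norm_sq_snd_le_of_flatRho_nonpos hp
  have hq2 := norm_sq_snd_le_of_flatRho_nonpos hq
  have h1 := norm_sq_convex_combination hab p.1 q.1
  have h2 := norm_sq_convex_combination hab p.2 q.2
  set d₁ := a * b * ‖p.1 - q.1‖ ^ 2 with hd₁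
  set d₂ := a * b * ‖p.2 - q.2‖ ^ 2 with hd₂
  have hd₁0 : 0 ≤ d₁ := by positivity
  have hd₂0 : 0 ≤ d₂ := by positivity
  set A := a * ‖p.2‖ ^ 2 + b * ‖q.2‖ ^ 2 with hA
  have hA0 : 0 ≤ A := by positivity
  have hAd : 0 ≤ A - d₂ := by rw [← h2]; positivity
  have h3 : expNegInvGlue A ≤ a * expNegInvGlue (‖p.2‖ ^ 2) + b * expNegInvGlue (‖q.2‖ ^ 2) := by
    simpa using convexOn_expNegInvGlue.2 ⟨sq_nonneg _, hp2⟩ ⟨sq_nonneg _, hq2⟩ ha.le hb.le hab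
  have h4 : expNegInvGlue (A - d₂) ≤ expNegInvGlue A := expNegInvGlue.monotone (by linarith)
  have h5 := mul_le_mul_of_nonneg_left h3 (Real.exp_pos 2).le
  have h6 := mul_le_mul_of_nonneg_left h4 (Real.exp_pos 2).le
  have hval : flatRho (a • p + b • q) =
      a * ‖p.1‖ ^ 2 + b * ‖q.1‖ ^ 2 - d₁ + Real.exp 2 * expNegInvGlue (A - d₂) - 1 := by
    rw [flatRho, ← h1, ← h2]
    rfl
  rw [hval, flatRho, flatRho]
  have hab' : (1 : ℝ) = a * 1 + b * 1 := by linarith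
  by_cases h7 : p.1 = q.1
  · have h8 : p.2 ≠ q.2 := fun h => hpq (Prod.ext h7 h)
    have h9 : 0 < d₂ := by
      have : 0 < ‖p.2 - q.2‖ := norm_pos_iff.2 (sub_ne_zero.2 h8)
      positivity
    have h10 := mul_lt_mul_of_pos_left (expNegInvGlue_strictMonoOn hAd hA0 (by linarith))
      (Real.exp_pos 2)
    nlinarith
  · have h9 : 0 < d₁ := by
      have : 0 < ‖p.1 - q.1‖ := norm_pos_iff.2 (sub_ne_zero.2 h7)
      positivity
    nlinarith

theorem flatRho_zero : flatRho 0 = -1 := by simp [flatRho, expNegInvGlue.zero]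

theorem flatRho_mono {p q : ℂ × ℂ} (h1 : ‖p.1‖ ≤ ‖q.1‖) (h2 : ‖p.2‖ ≤ ‖q.2‖) :
    flatRho p ≤ flatRho q := by
  have h3 := pow_le_pow_left₀ (norm_nonneg _) h1 2
  have h4 := mul_le_mul_of_nonneg_left (expNegInvGlue.monotone
    (pow_le_pow_left₀ (norm_nonneg _) h2 2)) (Real.exp_pos 2).le
  rw [flatRho, flatRho]
  linarith

/-- By convexity `flatRho` falls from `0` at `p` to `-1` at the origin at rate at least `1`, so its
derivative towards the origin cannot vanish. -/
theorem fderiv_flatRho_ne_zero {p : ℂ × ℂ} (hp : flatRho p = 0) : fderiv ℝ flatRho p ≠ 0 := by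
  intro h0
  have hne : p ≠ 0 := by
    rintro rfl
    rw [flatRho_zero] at hp
    norm_num at hp
  have hd : HasDerivAt (fun t : ℝ => flatRho (p + t • (-p))) 0 0 := by
    have h1 : HasDerivAt (fun t : ℝ => p + t • (-p)) (-p) 0 := by
      simpa using ((hasDerivAt_id (0 : ℝ)).smul_const (-p)).const_add p
    have h2 : HasFDerivAt flatRho (fderiv ℝ flatRho p) (p + (0 : ℝ) • (-p)) := by
      rw [zero_smul, add_zero]
      exact (contDiff_flatRho.differentiable (by simp) p).hasFDerivAt
    rw [h0] at h2
    exact h2.comp_hasDerivAt (0 : ℝ) h1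
  have hle : (0 : ℝ) ≤ -1 := by
    refine le_of_tendsto hd.tendsto_slope_zero_right ?_
    filter_upwards [Ioo_mem_nhdsGT (zero_lt_one (α := ℝ))] with t ht
    have h3 := flatRho_lt_of_ne hp.le (by rw [flatRho_zero]; norm_num) hne
      (show 0 < 1 - t by linarith [ht.2]) ht.1 (by ring)
    have h4 : (1 - t) • p + t • (0 : ℂ × ℂ) = p + t • (-p) := by
      rw [smul_zero, add_zero, sub_smul, one_smul, smul_neg, sub_eq_add_neg]
    rw [h4, hp, flatRho_zero] at h3
    simp only [zero_add, zero_smul, add_zero, hp, sub_zero, smul_eq_mul]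
    rw [inv_mul_le_iff₀ ht.1]
    linarith
  norm_num at hle

/-- The sublevel domain of `flatRho`. -/
def flatDomain : Set (ℂ × ℂ) := {p | flatRho p < 0}

theorem isOpen_flatDomain : IsOpen flatDomain :=
  isOpen_lt contDiff_flatRho.continuous continuous_const

theorem isCompact_flatRho_nonpos : IsCompact {p | flatRho p ≤ 0} := by
  refine Metric.isCompact_of_isClosed_isBounded
    (isClosed_le contDiff_flatRho.continuous continuous_const) ?_
  refine (isBounded_closedBall (x := (0 : ℂ × ℂ)) (r := 1)).subset fun p hp => ?_
  have h1 : ‖p.1‖ ^ 2 ≤ flatRho p + 1 := norm_fst_sq_le_of_flatRho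
  have h2 := norm_sq_snd_le_of_flatRho_nonpos hp
  have hp : flatRho p ≤ 0 := hp
  rw [mem_closedBall_zero_iff, Prod.norm_def, max_le_iff]
  constructor
  · nlinarith [norm_nonneg p.1]
  · nlinarith [norm_nonneg p.2]

theorem flatDomain_subset : flatDomain ⊆ {p | flatRho p ≤ 0} :=
  fun p hp => show flatRho p ≤ 0 from le_of_lt hp

theorem isCompleteReinhardt_flatDomain : IsCompleteReinhardt flatDomain := by
  intro z hz a b ha hb
  refine lt_of_le_of_lt (flatRho_mono ?_ ?_) hz
  · rw [norm_mul]
    exact mul_le_of_le_one_left (norm_nonneg _) ha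
  · rw [norm_mul]
    exact mul_le_of_le_one_left (norm_nonneg _) hb

theorem convex_flatDomain : Convex ℝ flatDomain := by
  rw [convex_iff_pairwise_pos]
  intro p hp q hq hpq a b ha hb hab
  have hp : flatRho p < 0 := hp
  have hq : flatRho q < 0 := hq
  have := flatRho_lt_of_ne hp.le hq.le hpq ha hb hab
  change flatRho _ < 0
  nlinarith

theorem isBoundedStrictlyConvexDomain_flatDomain : IsBoundedStrictlyConvexDomain flatDomain := by
  refine ⟨isOpen_flatDomain, ⟨0, by rw [flatDomain, mem_ofPred_eq, flatRho_zero]; norm_num⟩,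
    isCompact_flatRho_nonpos.isBounded.subset flatDomain_subset, convex_flatDomain, ?_⟩
  intro x y hseg
  by_contra hne
  have hfr : ∀ p ∈ frontier flatDomain, flatRho p = 0 := fun p hp =>
    frontier_lt_subset_eq contDiff_flatRho.continuous continuous_const hp
  have hx := hfr x (hseg (left_mem_segment ℝ x y))
  have hy := hfr y (hseg (right_mem_segment ℝ x y))
  have hm := hfr ((1 / 2 : ℝ) • x + (1 / 2 : ℝ) • y)
    (hseg ⟨1 / 2, 1 / 2, by norm_num, by norm_num, by norm_num, rfl⟩)
  have := flatRho_lt_of_ne hx.le hy.le hne (a := 1 / 2) (b := 1 / 2) (by norm_num) (by norm_num)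
    (by norm_num)
  rw [hx, hy, hm] at this
  norm_num at this

theorem half_smul_add_eq (x y : ℂ × ℂ) :
    (1 / 2 : ℂ) • (x + y) = (1 / 2 : ℝ) • x + (1 / 2 : ℝ) • y := by
  rw [smul_add]
  ext <;> simp

/-- Pairs in the closed sublevel set at distance at least `ε` form a compact set whose midpoints lie
in the open domain; a common dilation by `1 / r > 1` therefore keeps them inside. -/
theorem isUniformlyMidpointConvex_flatDomain : IsUniformlyMidpointConvex flatDomain := by
  intro ε hε
  set C : Set (ℂ × ℂ) := {p | flatRho p ≤ 0} with hC
  set K : Set ((ℂ × ℂ) × (ℂ × ℂ)) := (C ×ˢ C) ∩ {p | ε ≤ ‖p.1 - p.2‖} with hK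
  have hKc : IsCompact K := (isCompact_flatRho_nonpos.prod isCompact_flatRho_nonpos).inter_right
    (isClosed_le continuous_const (by fun_prop))
  have hmid : ∀ p ∈ K, (1 / 2 : ℂ) • (p.1 + p.2) ∈ flatDomain := by
    rintro p ⟨⟨hx, hy⟩, hε'⟩
    have hx : flatRho p.1 ≤ 0 := hx
    have hy : flatRho p.2 ≤ 0 := hy
    have hne : p.1 ≠ p.2 := by
      intro h
      have hε' : ε ≤ ‖p.1 - p.2‖ := hε'
      rw [h, sub_self, norm_zero] at hε'
      linarith
    have := flatRho_lt_of_ne hx hy hne (a := 1 / 2) (b := 1 / 2) (by norm_num) (by norm_num)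
      (by norm_num)
    rw [half_smul_add_eq]
    change flatRho _ < 0
    linarith
  have hev : ∀ᶠ r : ℝ in 𝓝 1, ∀ p ∈ K, ((r⁻¹ : ℝ) : ℂ) • ((1 / 2 : ℂ) • (p.1 + p.2)) ∈ flatDomain := by
    refine hKc.eventually_forall_of_forall_eventually
      (P := fun (r : ℝ) p => ((r⁻¹ : ℝ) : ℂ) • ((1 / 2 : ℂ) • (p.1 + p.2)) ∈ flatDomain)
      fun p hp => ?_
    have h1 : ContinuousAt (fun s : ℝ => ((s⁻¹ : ℝ) : ℂ)) 1 :=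
      Complex.continuous_ofReal.continuousAt.comp (continuousAt_inv₀ one_ne_zero)
    have h2 : ContinuousAt (fun z : ℝ × ((ℂ × ℂ) × (ℂ × ℂ)) =>
        ((z.1⁻¹ : ℝ) : ℂ) • ((1 / 2 : ℂ) • (z.2.1 + z.2.2))) (1, p) :=
      (ContinuousAt.comp (f := Prod.fst) (x := ((1 : ℝ), p)) h1 continuousAt_fst).smul
        (by fun_prop)
    exact h2.eventually_mem (isOpen_flatDomain.mem_nhds (by simpa using hmid p hp))
  obtain ⟨r, hr, hr'⟩ := ((hev.filter_mono nhdsWithin_le_nhds).and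
    (eventually_mem_set.2 (Ioo_mem_nhdsLT (zero_lt_one (α := ℝ))))).exists
  have hr0 : (r : ℂ) ≠ 0 := by exact_mod_cast hr'.1.ne'
  refine ⟨r, hr'.1.le, hr'.2, fun x hx y hy hxy => ⟨_, hr (x, y)
    ⟨⟨flatDomain_subset hx, flatDomain_subset hy⟩, hxy⟩, ?_⟩⟩
  rw [Complex.ofReal_inv, smul_inv_smul₀ hr0]

theorem hasUniqueGeodesics_flatDomain : HasUniqueGeodesics flatDomain := by
  refine isUniformlyMidpointConvex_flatDomain.hasUniqueGeodesics isOpen_flatDomain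
    (fun p hp c hc => isCompleteReinhardt_flatDomain p hp c c hc hc) fun x hx y hy => ?_
  rw [half_smul_add_eq]
  exact convex_flatDomain hx hy (by norm_num) (by norm_num) (by norm_num)

theorem one_zero_mem_frontier_flatDomain : ((1, 0) : ℂ × ℂ) ∈ frontier flatDomain := by
  have h0 : ∀ t : ℝ, flatRho ((t : ℂ), 0) = t ^ 2 - 1 := by
    intro t
    simp [flatRho, expNegInvGlue.zero]
  rw [isOpen_flatDomain.frontier_eq]
  refine ⟨?_, fun h => ?_⟩
  · have h1 : Continuous fun t : ℝ => (((t : ℂ), 0) : ℂ × ℂ) := by fun_prop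
    have h2 : (1 : ℝ) ∈ closure (Ico 0 1) := by
      rw [closure_Ico zero_ne_one]
      exact ⟨zero_le_one, le_rfl⟩
    have h3 : MapsTo (fun t : ℝ => (((t : ℂ), 0) : ℂ × ℂ)) (Ico 0 1) flatDomain := by
      intro t ht
      change flatRho _ < 0
      rw [h0]
      nlinarith [ht.1, ht.2]
    simpa using map_mem_closure h1 h2 h3
  · have h : flatRho (1, 0) < 0 := h
    have h1 := h0 1
    rw [Complex.ofReal_one] at h1
    rw [h1] at h
    norm_num at h

theorem isFlat_flatDomain : IsFlat flatDomain := by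
  intro N
  refine ⟨Real.exp 2 * (N + 1).factorial, by positivity, 1, one_pos, fun s x hs hs1 hx hxs => ?_⟩
  change flatRho _ < 0
  rw [flatRho]
  simp only [Complex.norm_real, Real.norm_of_nonneg hs, Real.norm_of_nonneg hx]
  have h1 := expNegInvGlue_le_factorial_mul_pow (sq_nonneg s) (N + 1)
  have h2 : (s ^ 2) ^ (N + 1) ≤ s ^ (N + 1) :=
    pow_le_pow_left₀ (sq_nonneg s) (by nlinarith) _
  have h3 : Real.exp 2 * expNegInvGlue (s ^ 2) ≤
      Real.exp 2 * (N + 1).factorial * s ^ (N + 1) := by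
    rw [mul_assoc]
    exact mul_le_mul_of_nonneg_left (h1.trans (mul_le_mul_of_nonneg_left h2 (by positivity)))
      (Real.exp_pos 2).le
  have h4 : 0 ≤ Real.exp 2 * expNegInvGlue (s ^ 2) :=
    mul_nonneg (Real.exp_pos 2).le (expNegInvGlue.nonneg _)
  nlinarith

theorem isLeftInverse_flatDomain_iff (F : ℂ × ℂ → ℂ) :
    IsLeftInverse flatDomain (fun l : ℂ => (l, 0)) F ↔ EqOn F Prod.fst flatDomain := by
  have hR := isCompleteReinhardt_flatDomain
  have hfr := one_zero_mem_frontier_flatDomain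
  have hD1 : ∀ p ∈ flatDomain, ‖p.1‖ < 1 :=
    fun _ hp => hR.norm_fst_lt_one isOpen_flatDomain hfr hp
  constructor
  · exact fun hF => isFlat_flatDomain.eqOn_fst isOpen_flatDomain hR hD1 hF
  · intro hF
    have h := isLeftInverse_fst hD1
    exact ⟨h.1.congr hF, h.2.1.congr hF.symm, fun l hl =>
      hF (hR.disc_mem hfr (mem_ball_zero_iff.1 hl))⟩

theorem proposition5 :
    (∀ D : Set (ℂ × ℂ), IsOpen D → IsConnected D → IsCompleteReinhardt D → IsPseudoconvex D →
      ((1, 0) : ℂ × ℂ) ∈ frontier D → HasSmoothBoundaryNear D (1, 0) →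
        IsComplexGeodesic D (fun l : ℂ => (l, 0)) ∧
        (HasUniqueLeftInverse D (fun l : ℂ => (l, 0)) ↔ IsOfInfiniteTypeAt D (1, 0))) ∧
    (∃ D : Set (ℂ × ℂ), IsBoundedStrictlyConvexDomain D ∧ IsCompleteReinhardt D ∧
      (∀ p ∈ frontier D, HasSmoothBoundaryNear D p) ∧ ((1, 0) : ℂ × ℂ) ∈ frontier D ∧
      HasUniqueGeodesics D ∧
      IsComplexGeodesic D (fun l : ℂ => (l, 0)) ∧
      ∀ F : ℂ × ℂ → ℂ, IsLeftInverse D (fun l : ℂ => (l, 0)) F ↔ EqOn F Prod.fst D) := by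
  refine ⟨fun D ho _ hR hpc hfr hs =>
    ⟨isComplexGeodesic_disc hR ho hfr, hasUniqueLeftInverse_iff hpc ho hR hfr hs⟩,
    flatDomain, isBoundedStrictlyConvexDomain_flatDomain, isCompleteReinhardt_flatDomain,
    fun p _ => ⟨univ, flatRho, isOpen_univ, mem_univ p, contDiff_flatRho.contDiffOn,
      fun _ _ => Iff.rfl, fun _ _ h => fderiv_flatRho_ne_zero h⟩,
    one_zero_mem_frontier_flatDomain, hasUniqueGeodesics_flatDomain,
    isComplexGeodesic_disc isCompleteReinhardt_flatDomain isOpen_flatDomain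
      one_zero_mem_frontier_flatDomain, isLeftInverse_flatDomain_iff⟩
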